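/- For a field $K$ and a finite directed graph $E=(E^0,E^1,s,r)$, let $L_K(E)$ denote the Leavitt path algebra of $E$ over $K$: the (associative) $K$-algebra generated by symbols $w$ ($w\in E^0$) and $e,e^*$ ($e\in E^1$) subject to the relations $ww'=\delta_{w,w'}w$ for $w,w'\in E^0$; $s(e)e=er(e)=e$ and $r(e)e^*=e^*s(e)=e^*$ for $e\in E^1$; $e^*f=\delta_{e,f}\,r(e)$ for $e,f\in E^1$; and $w=\sum_{s(e)=w}ee^*$ for every $w\in E^0$ that is the source of at least one edge. It is unital with $1=\sum_{w\in E^0}w$. Let $[L_K(E),L_K(E)]$ be the $K$-subspace of $L_K(E)$ spanned by all commutators $[x,y]=xy-yx$, viewed as a Lie $K$-algebra under the commutator bracket. A Lie $K$-algebra $L$ is called simple if $[L,L]\neq 0$ and its only Lie ideals are $0$ and $L$. Let $p$ be a prime and let $u,v\ge 2$ be integers. Let $E=E_{u,v,p}$ be the directed graph with exactly two vertices $v_1,v_2$ and exactly the following edges: $puv+1$ loops at $v_1$, $u$ edges from $v_1$ to $v_2$, $pu$ edges from $v_2$ to $v_1$, and $1+u$ loops at $v_2$. Then for every field $K$ the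 algebra $L_K(E)$ is simple, and if $\operatorname{char}(K)=p$, then the Lie $K$-algebra $[L_K(E),L_K(E)]$ is simple. -/

import Mathlib

universe w w₁ w₂ w₃

/-- A directed graph with vertex set `V` and edge set `E`; loops and parallel edges are allowed. -/
structure DirectedGraph (V : Type w₁) (E : Type w₂) where
  /-- the source of an edge -/
  s : E → V
  /-- the range of an edge -/
  r : E → V

namespace DirectedGraph

/-- A vertex is regular if it emits at least one and only finitely many edges. -/
def IsRegular {V : Type w₁} {E : Type w₂} (G : DirectedGraph V E) (v : V) : Prop :=
  {e | G.s e = v}.Finite ∧ {e | G.s e = v}.Nonempty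

end DirectedGraph

namespace Leavitt

/-- The generators `v`, `e`, `e*` of a Leavitt path algebra. -/
inductive Gen (V : Type w₁) (E : Type w₂) : Type (max w₁ w₂)
  | vertex (v : V)
  | edge (e : E)
  | ghost (e : E)

variable (K : Type w) [Field K] {V : Type w₁} {E : Type w₂}

/-- The family `P v`, `S e`, `T e` of elements of a (possibly non-unital) ring satisfies the
relations (V), (E1), (E2), (CK1) and (CK2) imposed on `v`, `e`, `e*`. -/
structure IsFamily (G : DirectedGraph V E) {B : Type w₃} [NonUnitalRing B]
    (P : V → B) (S T : E → B) : Prop where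
  vertex_mul_self : ∀ v, P v * P v = P v
  vertex_mul_of_ne : ∀ v w, v ≠ w → P v * P w = 0
  source_mul_edge : ∀ e, P (G.s e) * S e = S e
  edge_mul_range : ∀ e, S e * P (G.r e) = S e
  range_mul_ghost : ∀ e, P (G.r e) * T e = T e
  ghost_mul_source : ∀ e, T e * P (G.s e) = T e
  ghost_mul_edge_self : ∀ e, T e * S e = P (G.r e)
  ghost_mul_edge_of_ne : ∀ e f, e ≠ f → T e * S f = 0
  vertex_eq_sum : ∀ v, ∀ h : G.IsRegular v, P v = ∑ e ∈ h.1.toFinset, S e * T e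

/-- A generator, seen in the free unital `K`-algebra. -/
def gen (x : Gen V E) : FreeAlgebra K (Gen V E) := FreeAlgebra.ι K x

/-- The defining relations of the Leavitt path algebra of a graph with finitely many vertices.
The relations (V), (E1), (E2) make the sum of all vertices an identity element of the algebra that
they present, and `sum_vertex` says that this is the `1` of the unital algebra constructed here;
see `LeavittPathAlgebra.existsUnique_lift`. -/
inductive Rel [Fintype V] (G : DirectedGraph V E) :
    FreeAlgebra K (Gen V E) → FreeAlgebra K (Gen V E) → Prop
  | vertex_mul_self (v : V) : Rel G (gen K (.vertex v) * gen K (.vertex v)) (gen K (.vertex v))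
  | vertex_mul_of_ne (v w : V) (h : v ≠ w) : Rel G (gen K (.vertex v) * gen K (.vertex w)) 0
  | source_mul_edge (e : E) : Rel G (gen K (.vertex (G.s e)) * gen K (.edge e)) (gen K (.edge e))
  | edge_mul_range (e : E) : Rel G (gen K (.edge e) * gen K (.vertex (G.r e))) (gen K (.edge e))
  | range_mul_ghost (e : E) :
      Rel G (gen K (.vertex (G.r e)) * gen K (.ghost e)) (gen K (.ghost e))
  | ghost_mul_source (e : E) :
      Rel G (gen K (.ghost e) * gen K (.vertex (G.s e))) (gen K (.ghost e))
  | ghost_mul_edge_self (e : E) :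
      Rel G (gen K (.ghost e) * gen K (.edge e)) (gen K (.vertex (G.r e)))
  | ghost_mul_edge_of_ne (e f : E) (h : e ≠ f) : Rel G (gen K (.ghost e) * gen K (.edge f)) 0
  | vertex_eq_sum (v : V) (h : G.IsRegular v) :
      Rel G (gen K (.vertex v)) (∑ e ∈ h.1.toFinset, gen K (.edge e) * gen K (.ghost e))
  | sum_vertex : Rel G (∑ v, gen K (.vertex v)) 1

end Leavitt

/-- The Leavitt path algebra `L_K(G)` of a graph `G` with finitely many vertices. -/
abbrev LeavittPathAlgebra (K : Type w) [Field K] {V : Type w₁} {E : Type w₂} [Fintype V]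
    (G : DirectedGraph V E) : Type (max w w₁ w₂) :=
  RingQuot (Leavitt.Rel K G)

namespace LeavittPathAlgebra

open Leavitt

variable (K : Type w) [Field K] {V : Type w₁} {E : Type w₂} [Fintype V] (G : DirectedGraph V E)

/-- The commutator bracket `[x, y] = x * y - y * x` on `L_K(G)`. -/
instance instLieRing : LieRing (LeavittPathAlgebra K G) := LieRing.ofAssociativeRing

instance instLieAlgebra : LieAlgebra K (LeavittPathAlgebra K G) :=
  LieAlgebra.ofAssociativeAlgebra

/-- The `K`-subspace `[L_K(G), L_K(G)]` of `L_K(G)` spanned by all commutators, as a Lie ideal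
(and hence a Lie `K`-algebra). -/
abbrev commutators : LieIdeal K (LeavittPathAlgebra K G) :=
  LieAlgebra.derivedSeries K (LeavittPathAlgebra K G) 1

theorem commutators_eq_span :
    ((commutators K G : LieIdeal K (LeavittPathAlgebra K G)) :
      Submodule K (LeavittPathAlgebra K G)) =
      Submodule.span K {z | ∃ x y : LeavittPathAlgebra K G, x * y - y * x = z} :=
  LieAlgebra.coe_derivedSeries_one_eq K (LeavittPathAlgebra K G)

/-- The image of a generator in `L_K(G)`. -/
def of (x : Gen V E) : LeavittPathAlgebra K G :=
  RingQuot.mkAlgHom K (Rel K G) (gen K x)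

theorem isFamily : IsFamily G (fun v => of K G (.vertex v)) (fun e => of K G (.edge e))
    (fun e => of K G (.ghost e)) where
  vertex_mul_self v := by
    simpa [of] using RingQuot.mkAlgHom_rel K (Rel.vertex_mul_self (K := K) (G := G) v)
  vertex_mul_of_ne v w h := by
    simpa [of] using RingQuot.mkAlgHom_rel K (Rel.vertex_mul_of_ne (K := K) (G := G) v w h)
  source_mul_edge e := by
    simpa [of] using RingQuot.mkAlgHom_rel K (Rel.source_mul_edge (K := K) (G := G) e)
  edge_mul_range e := by
    simpa [of] using RingQuot.mkAlgHom_rel K (Rel.edge_mul_range (K := K) (G := G) e)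
  range_mul_ghost e := by
    simpa [of] using RingQuot.mkAlgHom_rel K (Rel.range_mul_ghost (K := K) (G := G) e)
  ghost_mul_source e := by
    simpa [of] using RingQuot.mkAlgHom_rel K (Rel.ghost_mul_source (K := K) (G := G) e)
  ghost_mul_edge_self e := by
    simpa [of] using RingQuot.mkAlgHom_rel K (Rel.ghost_mul_edge_self (K := K) (G := G) e)
  ghost_mul_edge_of_ne e f h := by
    simpa [of] using RingQuot.mkAlgHom_rel K (Rel.ghost_mul_edge_of_ne (K := K) (G := G) e f h)
  vertex_eq_sum v h := by
    simpa [of] using RingQuot.mkAlgHom_rel K (Rel.vertex_eq_sum (K := K) (G := G) v h)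

theorem sum_vertex : ∑ v, of K G (.vertex v) = 1 := by
  simpa [of] using RingQuot.mkAlgHom_rel K (Rel.sum_vertex (K := K) (G := G))

/-- The elements fixed by an idempotent `c` on both sides, as a non-unital subalgebra. -/
def corner {B : Type w₃} [NonUnitalRing B] [Module K B] [IsScalarTower K B B]
    [SMulCommClass K B B] (c : B) : NonUnitalSubalgebra K B where
  carrier := {x | c * x = x ∧ x * c = x}
  add_mem' := by
    rintro a b ⟨ha, ha'⟩ ⟨hb, hb'⟩
    exact ⟨by rw [mul_add, ha, hb], by rw [add_mul, ha', hb']⟩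
  zero_mem' := by simp
  mul_mem' := by
    rintro a b ⟨ha, ha'⟩ ⟨hb, hb'⟩
    exact ⟨by rw [← mul_assoc, ha], by rw [mul_assoc, hb']⟩
  smul_mem' := by
    rintro k a ⟨ha, ha'⟩
    exact ⟨by rw [mul_smul_comm, ha], by rw [smul_mul_assoc, ha']⟩

/-- `L_K(G)` is the universal `K`-algebra, unital or not, generated by elements `v`, `e`, `e*`
subject to (V), (E1), (E2), (CK1) and (CK2). -/
theorem existsUnique_lift {B : Type w₃} [NonUnitalRing B] [Module K B] [IsScalarTower K B B]
    [SMulCommClass K B B] {P : V → B} {S T : E → B} (hF : IsFamily G P S T) :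
    ∃! f : LeavittPathAlgebra K G →ₙₐ[K] B,
      (∀ v, f (of K G (.vertex v)) = P v) ∧ (∀ e, f (of K G (.edge e)) = S e) ∧
        (∀ e, f (of K G (.ghost e)) = T e) := by
  classical
  let c : B := ∑ v, P v
  have hcP : ∀ v, c * P v = P v := fun v => by
    simp only [c, Finset.sum_mul]
    rw [Finset.sum_eq_single v (fun w _ h => hF.vertex_mul_of_ne w v h) (by simp),
      hF.vertex_mul_self]
  have hPc : ∀ v, P v * c = P v := fun v => by
    simp only [c, Finset.mul_sum]
    rw [Finset.sum_eq_single v (fun w _ h => hF.vertex_mul_of_ne v w h.symm) (by simp),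
      hF.vertex_mul_self]
  have hcS : ∀ e, c * S e = S e := fun e => by
    rw [← hF.source_mul_edge, ← mul_assoc, hcP]
  have hSc : ∀ e, S e * c = S e := fun e => by
    rw [← hF.edge_mul_range, mul_assoc, hPc]
  have hcT : ∀ e, c * T e = T e := fun e => by
    rw [← hF.range_mul_ghost, ← mul_assoc, hcP]
  have hTc : ∀ e, T e * c = T e := fun e => by
    rw [← hF.ghost_mul_source, mul_assoc, hPc]
  have hcc : c * c = c := by
    change c * (∑ v, P v) = ∑ v, P v
    rw [Finset.mul_sum]
    exact Finset.sum_congr rfl fun v _ => hcP v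
  let C := corner K c
  let _ : Ring C :=
    { (inferInstance : NonUnitalRing C) with
      one := ⟨c, hcc, hcc⟩
      one_mul := fun x => Subtype.ext x.2.1
      mul_one := fun x => Subtype.ext x.2.2 }
  let _ : Algebra K C := Algebra.ofModule (fun k x y => smul_mul_assoc k x y)
    (fun k x y => mul_smul_comm k x y)
  let g : Gen V E → C
    | .vertex v => ⟨P v, hcP v, hPc v⟩
    | .edge e => ⟨S e, hcS e, hSc e⟩
    | .ghost e => ⟨T e, hcT e, hTc e⟩
  let ι : C →ₙₐ[K] B :=
    { toFun := Subtype.val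
      map_smul' := fun _ _ => rfl
      map_zero' := rfl
      map_add' := fun _ _ => rfl
      map_mul' := fun _ _ => rfl }
  have hι : Function.Injective ι := Subtype.val_injective
  have hgP : ∀ v, ι (g (.vertex v)) = P v := fun _ => rfl
  have hgS : ∀ e, ι (g (.edge e)) = S e := fun _ => rfl
  have hgT : ∀ e, ι (g (.ghost e)) = T e := fun _ => rfl
  have hrel : ∀ ⦃x y⦄, Rel K G x y → FreeAlgebra.lift K g x = FreeAlgebra.lift K g y := by
    intro x y h
    apply hι
    induction h with
    | vertex_mul_self v => simpa [gen, hgP, hgS, hgT] using hF.vertex_mul_self v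
    | vertex_mul_of_ne v w h => simpa [gen, hgP, hgS, hgT] using hF.vertex_mul_of_ne v w h
    | source_mul_edge e => simpa [gen, hgP, hgS, hgT] using hF.source_mul_edge e
    | edge_mul_range e => simpa [gen, hgP, hgS, hgT] using hF.edge_mul_range e
    | range_mul_ghost e => simpa [gen, hgP, hgS, hgT] using hF.range_mul_ghost e
    | ghost_mul_source e => simpa [gen, hgP, hgS, hgT] using hF.ghost_mul_source e
    | ghost_mul_edge_self e => simpa [gen, hgP, hgS, hgT] using hF.ghost_mul_edge_self e
    | ghost_mul_edge_of_ne e f h => simpa [gen, hgP, hgS, hgT] using hF.ghost_mul_edge_of_ne e f h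
    | vertex_eq_sum v h => simpa [gen, hgP, hgS, hgT] using hF.vertex_eq_sum v h
    | sum_vertex => simp only [gen, map_sum, FreeAlgebra.lift_ι_apply, map_one]; rfl
  let F : LeavittPathAlgebra K G →ₐ[K] C := RingQuot.liftAlgHom K ⟨FreeAlgebra.lift K g, hrel⟩
  have hFof : ∀ x, F (of K G x) = g x := fun x => by simp [F, of, gen]
  refine ⟨ι.comp (F : LeavittPathAlgebra K G →ₙₐ[K] C), ⟨fun v => ?_, fun e => ?_, fun e => ?_⟩, ?_⟩
  · exact congrArg ι (hFof (.vertex v))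
  · exact congrArg ι (hFof (.edge e))
  · exact congrArg ι (hFof (.ghost e))
  · suffices huniq : ∀ f₁ f₂ : LeavittPathAlgebra K G →ₙₐ[K] B,
        (∀ x, f₁ (of K G x) = f₂ (of K G x)) → f₁ = f₂ by
      rintro f ⟨h₁, h₂, h₃⟩
      apply huniq
      rintro (v | e | e)
      · exact (h₁ v).trans (congrArg ι (hFof (.vertex v))).symm
      · exact (h₂ e).trans (congrArg ι (hFof (.edge e))).symm
      · exact (h₃ e).trans (congrArg ι (hFof (.ghost e))).symm
    intro f₁ f₂ h
    ext z
    obtain ⟨z, rfl⟩ := RingQuot.mkAlgHom_surjective K (Rel K G) z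
    induction z using FreeAlgebra.induction with
    | grade0 k =>
      rw [AlgHom.commutes, Algebra.algebraMap_eq_smul_one, map_smul, map_smul, ← sum_vertex,
        map_sum, map_sum]
      simp only [h]
    | grade1 x => exact h x
    | mul a b ha hb => rw [map_mul, map_mul, map_mul, ha, hb]
    | add a b ha hb => rw [map_add, map_add, map_add, ha, hb]

end LeavittPathAlgebra

/-- The graph with two vertices `v₁ = 0` and `v₂ = 1`, and with `p * u * v + 1` loops at `v₁`,
`u` edges from `v₁` to `v₂`, `p * u` edges from `v₂` to `v₁` and `1 + u` loops at `v₂`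
(the four summands of the edge set, in this order). -/
def twoVertexGraph (u v p : ℕ) :
    DirectedGraph (Fin 2) (Fin (p * u * v + 1) ⊕ Fin u ⊕ Fin (p * u) ⊕ Fin (1 + u)) where
  s := Sum.elim (fun _ => 0) (Sum.elim (fun _ => 0) (Sum.elim (fun _ => 1) (fun _ => 1)))
  r := Sum.elim (fun _ => 0) (Sum.elim (fun _ => 1) (Sum.elim (fun _ => 0) (fun _ => 1)))

/-!
Let `L = L_K(G)` and let `x ∈ L` be nonzero. Some product of `x` with a long path is nonzero, and it
contains no ghost edges any more. Ghost edges then strip edges off the remaining paths from the left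
until a vertex `v` occurs, so that `a x b = v + z` with `z` a combination of paths of bounded
positive length. If `e` is a loop at `v` and `f ≠ e` is another edge out of `v`, then
`f* (e*)ᴺ (v + z) eᴺ f = r(f)` for large `N`. Hence a nonzero ideal contains a vertex, and by strong
connectivity it contains all of them.

Lie simplicity is an argument in the style of Herstein. In a simple ring `A` with at least three
complete orthogonal nonzero idempotents (here the `e e*`), brackets with off-diagonal Peirce
components show that a Lie ideal of `[A, A]` is central or contains all commutators. The center is a
field, so a nonzero central element of `[A, A]` would give `1 ∈ [A, A]`.

That `1 ∉ [L, L]` is seen by a trace. Modulo commutators, `x` agrees with `Θ x = ∑ e* x e`. Let `ε`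
be a weight on the vertices with `ε(v) = ∑ ε(r(e))`, summed over the edges `e` out of `v`, and let
`t` be a linear form with `t(v) = ε(v)` that vanishes on elements of nonzero degree. Then `t(Θⁿ x)`
is zero for large `n` if `x ∈ [L, L]`, but it is `∑ ε(v)` for `x = 1`. In characteristic `p` the
weight `ε = (1, 0)` has this property for the given graph.
-/

section HersteinLieIdeals

attribute [local instance] LieRing.ofAssociativeRing

section SimpleRing

variable {A : Type*} [Ring A] [IsSimpleRing A]

theorem mem_of_forall_mul_mul_mem (W : AddSubgroup A) {z : A} (hz : z ≠ 0)
    (h : ∀ a b, a * z * b ∈ W) (x : A) : x ∈ W := by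
  have hspan : TwoSidedIdeal.span {z} = (⊤ : TwoSidedIdeal A) :=
    (eq_bot_or_eq_top _).resolve_left fun hbot => hz <| by
      have : z ∈ TwoSidedIdeal.span {z} := TwoSidedIdeal.subset_span rfl
      rwa [hbot, TwoSidedIdeal.mem_bot] at this
  have hx : x ∈ TwoSidedIdeal.span {z} := hspan ▸ TwoSidedIdeal.mem_top A
  rw [TwoSidedIdeal.mem_span_iff_mem_addSubgroup_closure] at hx
  refine (AddSubgroup.closure_le W).2 ?_ hx
  rintro _ ⟨_, ⟨a, -, _, rfl, rfl⟩, b, -, rfl⟩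
  exact h a b

theorem mul_mul_mem_of_forall_mul_mul_mem (W : AddSubgroup A) {z : A} (hz : z ≠ 0) {p q : A}
    (h : ∀ a b, p * (a * z * b) * q ∈ W) (x : A) : p * x * q ∈ W :=
  mem_of_forall_mul_mul_mem
    (W.comap ((AddMonoidHom.mulRight q).comp (AddMonoidHom.mulLeft p))) hz h x

theorem exists_mul_mul_ne_zero {y z : A} (hy : y ≠ 0) (hz : z ≠ 0) : ∃ a, y * a * z ≠ 0 := by
  by_contra! h
  have h1 : (1 : A) ∈ (AddMonoidHom.mulLeft y).ker :=
    mem_of_forall_mul_mul_mem _ hz (fun a b => by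
      rw [AddMonoidHom.mem_ker, AddMonoidHom.coe_mulLeft, ← mul_assoc, ← mul_assoc, h, zero_mul]) 1
  exact hy (by simpa [AddMonoidHom.mem_ker] using h1)

end SimpleRing

section Peirce

variable {A : Type*} [Ring A] {ι : Type*} {e : ι → A}

theorem mem_of_forall_peirce_mem [Fintype ι] (he : CompleteOrthogonalIdempotents e)
    (W : AddSubgroup A) {x : A} (h : ∀ i j, e i * x * e j ∈ W) : x ∈ W := by
  have hx : x = ∑ i, ∑ j, e i * x * e j := by
    simp_rw [← Finset.mul_sum, ← Finset.sum_mul, he.complete, one_mul, mul_one]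
  rw [hx]
  exact W.sum_mem fun i _ => W.sum_mem fun j _ => h i j

theorem peirce_mul_peirce_of_ne (he : OrthogonalIdempotents e) {i j k l : ι} (hjk : j ≠ k)
    (x y : A) : e i * x * e j * (e k * y * e l) = 0 := by
  rw [mul_assoc (e k), mul_assoc (e i * x), ← mul_assoc (e j), he.ortho hjk, zero_mul, mul_zero]

theorem peirce_mul_peirce (he : OrthogonalIdempotents e) (i j k : ι) (x y : A) :
    e i * x * e j * (e j * y * e k) = e i * (x * e j * y) * e k := by
  simp only [mul_assoc, (he.idem j).mul_self_mul]

theorem lie_peirce_peirce (he : OrthogonalIdempotents e) {i j k : ι} (hik : k ≠ i) (x y : A) :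
    ⁅e i * x * e j, e j * y * e k⁆ = e i * (x * e j * y) * e k := by
  rw [Ring.lie_def, peirce_mul_peirce he, peirce_mul_peirce_of_ne he hik, sub_zero]

theorem lie_idempotent_peirce (he : OrthogonalIdempotents e) {i j : ι} (hij : i ≠ j) (x : A) :
    ⁅e i, e i * x * e j⁆ = e i * x * e j := by
  rw [Ring.lie_def, mul_assoc _ (e j), he.ortho hij.symm, mul_zero, sub_zero, ← mul_assoc,
    ← mul_assoc, (he.idem i).eq]

theorem subring_eq_top_of_offDiag_mem [IsSimpleRing A] [Fintype ι] [Nontrivial ι]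
    (he : CompleteOrthogonalIdempotents e) (hne : ∀ i, e i ≠ 0) {T : Subring A}
    (hT : ∀ ⦃i j⦄, i ≠ j → ∀ x, e i * x * e j ∈ T) : T = ⊤ := by
  refine eq_top_iff.2 fun x _ => mem_of_forall_peirce_mem he T.toAddSubgroup fun i j => ?_
  obtain rfl | hij := eq_or_ne i j
  · obtain ⟨j, hji⟩ := exists_ne i
    refine mul_mul_mem_of_forall_mul_mul_mem T.toAddSubgroup (hne j) (fun a b => ?_) x
    rw [← peirce_mul_peirce he.toOrthogonalIdempotents]
    exact T.mul_mem (hT hji.symm a) (hT hji b)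
  · exact hT hij x

theorem mem_center_of_commute_offDiag [IsSimpleRing A] [Fintype ι] [Nontrivial ι]
    (he : CompleteOrthogonalIdempotents e) (hne : ∀ i, e i ≠ 0) {u : A}
    (h : ∀ ⦃i j⦄, i ≠ j → ∀ x, Commute (e i * x * e j) u) : u ∈ Subring.center A := by
  have htop : Subring.centralizer {u} = ⊤ :=
    subring_eq_top_of_offDiag_mem he hne fun i j hij x => Subring.mem_centralizer_iff.2
      fun g hg => Set.mem_singleton_iff.1 hg ▸ (h hij x).eq.symm
  have hmem (g : A) : g ∈ Subring.centralizer {u} := htop ▸ Subring.mem_top g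
  exact Subring.mem_center_iff.2 fun g =>
    (Subring.mem_centralizer_iff.1 (hmem g) u (Set.mem_singleton u)).symm

theorem commute_of_offDiag_eq_zero [Fintype ι] (he : CompleteOrthogonalIdempotents e) {u : A}
    (h : ∀ ⦃i j⦄, i ≠ j → e i * u * e j = 0) (i : ι) : Commute (e i) u := by
  have hleft : e i * u = e i * u * e i := by
    conv_lhs => rw [← mul_one (e i * u), ← he.complete, Finset.mul_sum]
    exact Fintype.sum_eq_single i fun j hji => h hji.symm
  have hright : u * e i = e i * u * e i := by
    conv_lhs => rw [← one_mul (u * e i), ← he.complete, Finset.sum_mul]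
    exact (Fintype.sum_eq_single i fun j hji => (mul_assoc _ _ _).symm.trans (h hji)).trans
      (mul_assoc _ _ _).symm
  exact hleft.trans hright.symm

end Peirce

/-- An additive subgroup `U` is stable under bracketing with the off-diagonal Peirce components
`e i * A * e j`, `i ≠ j`. Every Lie ideal of `[A, A]` has this property. -/
def IsOffDiagStable {A ι : Type*} [Ring A] (e : ι → A) (U : AddSubgroup A) : Prop :=
  ∀ ⦃i j⦄, i ≠ j → ∀ x, ∀ u ∈ U, ⁅e i * x * e j, u⁆ ∈ U

namespace IsOffDiagStable

variable {A : Type*} [Ring A] {ι : Type*} {e : ι → A} {U : AddSubgroup A}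

theorem exists_peirce_mem_ne_zero [IsSimpleRing A] (hU : IsOffDiagStable e U)
    (he : OrthogonalIdempotents e) (hne : ∀ i, e i ≠ 0) {a b d : ι} (hab : a ≠ b) (had : a ≠ d)
    (hbd : b ≠ d) {u : A} (hu : u ∈ U) (hdua : e d * u * e a ≠ 0) :
    ∃ w, e a * w * e d ∈ U ∧ e a * w * e d ≠ 0 := by
  obtain ⟨y, hy⟩ := exists_mul_mul_ne_zero (hne a) hdua
  obtain ⟨x, hx⟩ := exists_mul_mul_ne_zero hy (hne b)
  obtain ⟨z, hz⟩ := exists_mul_mul_ne_zero hx (hne d)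
  have hmem : ⁅e b * z * e d, ⁅e a * y * e d, ⁅e a * x * e b, u⁆⁆⁆ ∈ U :=
    hU hbd z _ (hU had y _ (hU hab x u hu))
  have hbracket : ⁅e b * z * e d, ⁅e a * y * e d, ⁅e a * x * e b, u⁆⁆⁆ =
      e a * (y * (e d * u * e a) * x * e b * z) * e d := by
    have hexpand (r s t : A) : ⁅r, ⁅t, ⁅s, u⁆⁆⁆ = t * u * (s * r) + r * t * ⁅s, u⁆ - r * s * u * t +
        r * u * (s * t) - t * s * u * r + s * u * (t * r) - u * (s * t) * r := by
      simp only [Ring.lie_def]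
      noncomm_ring
    rw [hexpand, peirce_mul_peirce_of_ne he had.symm, peirce_mul_peirce_of_ne he had.symm,
      peirce_mul_peirce_of_ne he hab.symm, peirce_mul_peirce_of_ne he had.symm,
      peirce_mul_peirce_of_ne he hbd.symm, peirce_mul_peirce he]
    simp only [zero_mul, mul_zero, add_zero, sub_zero, mul_assoc]
  refine ⟨y * (e d * u * e a) * x * e b * z, hbracket ▸ hmem, ?_⟩
  simpa only [mul_assoc] using hz

theorem peirce_mem_of_peirce_mem_right [IsSimpleRing A] (hU : IsOffDiagStable e U)
    (he : OrthogonalIdempotents e) (hne : ∀ i, e i ≠ 0) {i j k : ι} (hij : i ≠ j) (hik : i ≠ k)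
    (h : ∀ x, e j * x * e k ∈ U) (x : A) : e i * x * e k ∈ U := by
  refine mul_mul_mem_of_forall_mul_mul_mem U (hne j) (fun a b => ?_) x
  rw [← lie_peirce_peirce he hik.symm]
  exact hU hij a _ (h b)

theorem peirce_mem_of_peirce_mem_left [IsSimpleRing A] (hU : IsOffDiagStable e U)
    (he : OrthogonalIdempotents e) (hne : ∀ i, e i ≠ 0) {i j k : ι} (hjk : j ≠ k) (hik : i ≠ k)
    (h : ∀ x, e i * x * e j ∈ U) (x : A) : e i * x * e k ∈ U := by
  refine mul_mul_mem_of_forall_mul_mul_mem U (hne j) (fun a b => ?_) x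
  rw [← lie_peirce_peirce he hik.symm, ← lie_skew]
  exact U.neg_mem (hU hjk b _ (h a))

theorem offDiag_mem_of_peirce_mem [IsSimpleRing A] (hU : IsOffDiagStable e U)
    (he : OrthogonalIdempotents e) (hne : ∀ i, e i ≠ 0) (hcard : 3 ≤ ENat.card ι) {k l : ι}
    (h : ∀ x, e k * x * e l ∈ U) ⦃i j : ι⦄ (hij : i ≠ j) (x : A) : e i * x * e j ∈ U := by
  have hcol : ∀ ⦃i⦄, i ≠ l → ∀ x, e i * x * e l ∈ U := fun i hil => by
    obtain rfl | hik := eq_or_ne i k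
    · exact h
    · exact hU.peirce_mem_of_peirce_mem_right he hne hik hil h
  have hrow : ∀ ⦃i j⦄, i ≠ l → i ≠ j → ∀ x, e i * x * e j ∈ U := fun i j hil hij => by
    obtain rfl | hjl := eq_or_ne j l
    · exact hcol hil
    · exact hU.peirce_mem_of_peirce_mem_left he hne hjl.symm hij (hcol hil)
  obtain ⟨m, hmj, hml⟩ := ENat.exists_ne_ne_of_three_le hcard j l
  obtain rfl | hil := eq_or_ne i l
  · exact hU.peirce_mem_of_peirce_mem_right he hne hml.symm hij (hrow hml hmj) x
  · exact hrow hil hij x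

theorem offDiag_mem_of_peirce_ne_zero [IsSimpleRing A] (hU : IsOffDiagStable e U)
    (he : OrthogonalIdempotents e) (hne : ∀ i, e i ≠ 0) (hcard : 3 ≤ ENat.card ι) {k l : ι}
    (hkl : k ≠ l) {w : A} (hw : e k * w * e l ∈ U) (hw0 : e k * w * e l ≠ 0) ⦃i j : ι⦄
    (hij : i ≠ j) (x : A) : e i * x * e j ∈ U := by
  obtain ⟨c, hck, hcl⟩ := ENat.exists_ne_ne_of_three_le hcard k l
  refine hU.offDiag_mem_of_peirce_mem he hne hcard (k := c) (l := k) ?_ hij x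
  refine mul_mul_mem_of_forall_mul_mul_mem U hw0 fun a b => ?_
  have hbracket : ⁅⁅e c * a * e k, e k * w * e l⁆, e l * b * e k⁆ =
      e c * (a * (e k * w * e l) * b) * e k := by
    rw [lie_peirce_peirce he hcl.symm, lie_peirce_peirce he hck.symm]
    simp only [mul_assoc]
  rw [← hbracket, ← lie_skew]
  exact U.neg_mem (hU hkl.symm b _ (hU hck a _ hw))

theorem lie_mem_of_offDiag_mem [IsSimpleRing A] [Fintype ι] [Nontrivial ι]
    (hU : IsOffDiagStable e U) (he : CompleteOrthogonalIdempotents e) (hne : ∀ i, e i ≠ 0)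
    (h : ∀ ⦃i j⦄, i ≠ j → ∀ x, e i * x * e j ∈ U) (x y : A) : ⁅x, y⁆ ∈ U := by
  let T : Subring A :=
    { carrier := {x | ∀ y, ⁅x, y⁆ ∈ U}
      mul_mem' := fun {a b} ha hb y => by
        have hcyc : ⁅a * b, y⁆ = ⁅a, b * y⁆ + ⁅b, y * a⁆ := by
          simp only [Ring.lie_def]
          noncomm_ring
        exact hcyc ▸ U.add_mem (ha _) (hb _)
      one_mem' := fun y => by simp [Ring.lie_def, U.zero_mem]
      add_mem' := fun ha hb y => by simpa only [add_lie] using U.add_mem (ha y) (hb y)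
      zero_mem' := fun y => by simp [U.zero_mem]
      neg_mem' := fun ha y => by simpa only [neg_lie] using U.neg_mem (ha y) }
  have hT : T = ⊤ := subring_eq_top_of_offDiag_mem he hne fun i j hij x y => by
    refine mem_of_forall_peirce_mem he (U.comap (LieModule.toEnd ℤ A A (e i * x * e j)))
      fun k l => ?_
    change ⁅e i * x * e j, e k * y * e l⁆ ∈ U
    obtain rfl | hkl := eq_or_ne k l
    · obtain rfl | hkj := eq_or_ne k j
      · rw [lie_peirce_peirce he.toOrthogonalIdempotents hij.symm]
        exact h hij _
      obtain rfl | hki := eq_or_ne k i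
      · rw [← lie_skew, lie_peirce_peirce he.toOrthogonalIdempotents hij.symm]
        exact U.neg_mem (h hij _)
      · rw [Ring.lie_def, peirce_mul_peirce_of_ne he.toOrthogonalIdempotents hkj.symm,
          peirce_mul_peirce_of_ne he.toOrthogonalIdempotents hki, sub_zero]
        exact U.zero_mem
    · exact hU hij x _ (h hkl y)
  exact (hT ▸ Subring.mem_top x : x ∈ T) y

theorem forall_mem_center_or_forall_lie_mem [IsSimpleRing A] [Fintype ι]
    (hU : IsOffDiagStable e U) (he : CompleteOrthogonalIdempotents e) (hne : ∀ i, e i ≠ 0)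
    (hcard : 3 ≤ ENat.card ι) : (∀ u ∈ U, u ∈ Subring.center A) ∨ ∀ x y : A, ⁅x, y⁆ ∈ U := by
  have : Nontrivial ι := (ENat.one_lt_card_iff_nontrivial ι).1 (lt_of_lt_of_le (by norm_num) hcard)
  by_cases hoff : ∃ i j, i ≠ j ∧ ∃ w, e i * w * e j ∈ U ∧ e i * w * e j ≠ 0
  · obtain ⟨i, j, hij, w, hw, hw0⟩ := hoff
    exact .inr (hU.lie_mem_of_offDiag_mem he hne
      (hU.offDiag_mem_of_peirce_ne_zero he.toOrthogonalIdempotents hne hcard hij hw hw0))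
  push Not at hoff
  refine .inl fun u hu => ?_
  have hdiag : ∀ ⦃i j⦄, i ≠ j → e i * u * e j = 0 := fun i j hij => by
    by_contra hne0
    obtain ⟨b, hbi, hbj⟩ := ENat.exists_ne_ne_of_three_le hcard i j
    obtain ⟨w, hw, hw0⟩ := hU.exists_peirce_mem_ne_zero he.toOrthogonalIdempotents hne hbj.symm
      hij.symm hbi hu hne0
    exact hw0 (hoff j i hij.symm w hw)
  have hcomm := commute_of_offDiag_eq_zero he hdiag
  refine mem_center_of_commute_offDiag he hne fun i j hij x => ?_
  have hbracket : ⁅e i * x * e j, u⁆ = e i * ⁅x, u⁆ * e j := by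
    simp only [Ring.lie_def, mul_sub, sub_mul, mul_assoc, (hcomm j).eq]
    rw [← mul_assoc u, ← (hcomm i).eq, mul_assoc]
  have hzero : ⁅e i * x * e j, u⁆ = 0 := by
    rw [hbracket]
    exact hoff i j hij _ (hbracket ▸ hU hij x u hu)
  exact sub_eq_zero.1 hzero

end IsOffDiagStable

section Derived

variable {R A : Type*} [CommRing R] [Ring A] [Algebra R A]

attribute [local instance] LieAlgebra.ofAssociativeAlgebra

theorem lie_mem_derivedSeries_one {R L : Type*} [CommRing R] [LieRing L] [LieAlgebra R L]
    (x y : L) : ⁅x, y⁆ ∈ LieAlgebra.derivedSeries R L 1 :=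
  LieSubmodule.lie_mem_lie (LieSubmodule.mem_top x) (LieSubmodule.mem_top y)

theorem derivedSeries_one_le_iff {R L : Type*} [CommRing R] [LieRing L] [LieAlgebra R L]
    {U : Submodule R L} :
    (LieAlgebra.derivedSeries R L 1).toSubmodule ≤ U ↔ ∀ x y : L, ⁅x, y⁆ ∈ U := by
  refine ⟨fun h x y => h (lie_mem_derivedSeries_one x y), fun h => ?_⟩
  refine (LieAlgebra.coe_derivedSeries_one_eq R L).le.trans (Submodule.span_le.2 ?_)
  rintro _ ⟨x, y, rfl⟩
  exact h x y

theorem mul_mem_derivedSeries_one {c z : A} (hc : c ∈ Subring.center A)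
    (hz : z ∈ LieAlgebra.derivedSeries R A 1) : c * z ∈ LieAlgebra.derivedSeries R A 1 := by
  suffices h : (LieAlgebra.derivedSeries R A 1).toSubmodule ≤
      (LieAlgebra.derivedSeries R A 1).toSubmodule.comap (LinearMap.mulLeft R c) from h hz
  refine derivedSeries_one_le_iff.2 fun x y => ?_
  have hcxy : c * ⁅x, y⁆ = ⁅c * x, y⁆ := by
    rw [Ring.lie_def, Ring.lie_def, mul_sub, ← mul_assoc, ← mul_assoc, ← mul_assoc,
      Subring.mem_center_iff.1 hc y]
  change c * ⁅x, y⁆ ∈ LieAlgebra.derivedSeries R A 1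
  exact hcxy ▸ lie_mem_derivedSeries_one _ _

theorem eq_zero_of_mem_center_of_mem_derivedSeries_one [IsSimpleRing A]
    (h1 : (1 : A) ∉ LieAlgebra.derivedSeries R A 1) {z : A} (hz : z ∈ Subring.center A)
    (hzD : z ∈ LieAlgebra.derivedSeries R A 1) : z = 0 := by
  by_contra hz0
  obtain ⟨c, hc⟩ := (IsSimpleRing.isField_center A).mul_inv_cancel (a := ⟨z, hz⟩)
    fun h => hz0 (congrArg Subtype.val h)
  have hzc : z * c = 1 := congrArg Subtype.val hc
  rw [← hzc, Subring.mem_center_iff.1 c.2 z] at h1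
  exact h1 (mul_mem_derivedSeries_one c.2 hzD)

variable [IsSimpleRing A] {ι : Type*} {e : ι → A}

theorem not_isLieAbelian_derivedSeries_one [Nontrivial ι] (he : OrthogonalIdempotents e)
    (hne : ∀ i, e i ≠ 0) : ¬ IsLieAbelian (LieAlgebra.derivedSeries R A 1) := by
  intro hab
  obtain ⟨i, j, hij⟩ := exists_pair_ne ι
  obtain ⟨a, ha⟩ := exists_mul_mul_ne_zero (hne i) (hne j)
  obtain ⟨b, hb⟩ := exists_mul_mul_ne_zero ha (hne i)
  have hmem {k l : ι} (hkl : k ≠ l) (x : A) : e k * x * e l ∈ LieAlgebra.derivedSeries R A 1 :=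
    lie_idempotent_peirce he hkl x ▸ lie_mem_derivedSeries_one _ _
  have hlie : ⁅e i * a * e j, e j * b * e i⁆ = 0 :=
    congrArg Subtype.val (hab.trivial ⟨_, hmem hij a⟩ ⟨_, hmem hij.symm b⟩)
  have hprod : e i * a * e j * b * e i = e i * ⁅e i * a * e j, e j * b * e i⁆ := by
    rw [Ring.lie_def, mul_sub, peirce_mul_peirce he, peirce_mul_peirce he]
    simp only [← mul_assoc, (he.idem i).eq, he.ortho hij, zero_mul, sub_zero]
  exact hb (by rw [hprod, hlie, mul_zero])

theorem isSimple_derivedSeries_one [Fintype ι] (he : CompleteOrthogonalIdempotents e)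
    (hne : ∀ i, e i ≠ 0) (hcard : 3 ≤ ENat.card ι)
    (h1 : (1 : A) ∉ LieAlgebra.derivedSeries R A 1) :
    LieAlgebra.IsSimple R (LieAlgebra.derivedSeries R A 1) where
  eq_bot_or_eq_top I := by
    let U : Submodule R A :=
      I.toSubmodule.map (LieAlgebra.derivedSeries R A 1).toSubmodule.subtype
    have hU : IsOffDiagStable e U.toAddSubgroup := by
      rintro i j hij x _ ⟨u, hu, rfl⟩
      have hmem : e i * x * e j ∈ LieAlgebra.derivedSeries R A 1 :=
        lie_idempotent_peirce he.toOrthogonalIdempotents hij x ▸ lie_mem_derivedSeries_one _ _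
      exact ⟨⁅(⟨_, hmem⟩ : LieAlgebra.derivedSeries R A 1), u⁆, I.lie_mem hu, rfl⟩
    obtain hcent | hlie := hU.forall_mem_center_or_forall_lie_mem he hne hcard
    · refine .inl ((LieSubmodule.eq_bot_iff I).2 fun u hu => Subtype.ext ?_)
      exact eq_zero_of_mem_center_of_mem_derivedSeries_one h1 (hcent u ⟨u, hu, rfl⟩) u.2
    · refine .inr (eq_top_iff.2 fun u _ => ?_)
      obtain ⟨u', hu', h'⟩ := derivedSeries_one_le_iff.2 hlie u.2
      rwa [← (Subtype.ext h' : u' = u)]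
  non_abelian := by
    have : Nontrivial ι :=
      (ENat.one_lt_card_iff_nontrivial ι).1 (lt_of_lt_of_le (by norm_num) hcard)
    exact not_isLieAbelian_derivedSeries_one he.toOrthogonalIdempotents hne

end Derived

end HersteinLieIdeals

section EventualKer

variable {R M M' : Type*} [Semiring R] [AddCommMonoid M] [Module R M] [AddCommMonoid M']
  [Module R M'] {f : Module.End R M} {t : M →ₗ[R] M'}

variable (f t) in
/-- The submodule of all `x` such that `t (f ^ n x)` vanishes for all large `n`. -/
def eventualKer : Submodule R M where
  carrier := {x | ∀ᶠ n in Filter.atTop, t ((f ^ n) x) = 0}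
  add_mem' hx hy := by
    filter_upwards [hx, hy] with n hx hy
    rw [map_add, map_add, hx, hy, add_zero]
  zero_mem' := .of_forall fun n => by rw [map_zero, map_zero]
  smul_mem' c x hx := hx.mono fun n hx => by rw [map_smul, map_smul, hx, smul_zero]

theorem mem_eventualKer_of_apply_mem {x : M} (hx : f x ∈ eventualKer f t) :
    x ∈ eventualKer f t := by
  change ∀ᶠ n in Filter.atTop, t ((f ^ n) x) = 0
  rw [← Filter.map_add_atTop_eq_nat 1, Filter.eventually_map]
  exact hx.mono fun n hn => by rwa [pow_succ, Module.End.mul_apply]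

end EventualKer

namespace LeavittPathAlgebra

open Leavitt

variable {K : Type*} [Field K] {V E : Type*} [Fintype V] {G : DirectedGraph V E}

local notation "P" v:max => of K G (Gen.vertex v)
local notation "S" e:max => of K G (Gen.edge e)
local notation "T" e:max => of K G (Gen.ghost e)

@[elab_as_elim]
theorem induction {motive : LeavittPathAlgebra K G → Prop}
    (algebraMap : ∀ k, motive (algebraMap K (LeavittPathAlgebra K G) k))
    (of : ∀ g, motive (of K G g))
    (mul : ∀ x y, motive x → motive y → motive (x * y))
    (add : ∀ x y, motive x → motive y → motive (x + y)) (x : LeavittPathAlgebra K G) :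
    motive x := by
  obtain ⟨z, rfl⟩ := RingQuot.mkAlgHom_surjective K (Rel K G) x
  induction z using FreeAlgebra.induction with
  | grade0 k => exact ((RingQuot.mkAlgHom K (Rel K G)).commutes k).symm ▸ algebraMap k
  | grade1 g => exact of g
  | mul a b ha hb => simpa only [map_mul] using mul _ _ ha hb
  | add a b ha hb => simpa only [map_add] using add _ _ ha hb

theorem submodule_eq_top_of_of_mul_mem {W : Submodule K (LeavittPathAlgebra K G)}
    (hone : 1 ∈ W) (hmul : ∀ g, ∀ x ∈ W, of K G g * x ∈ W) : W = ⊤ := by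
  suffices h : ∀ a, ∀ x ∈ W, a * x ∈ W from eq_top_iff.2 fun a _ => mul_one a ▸ h a 1 hone
  intro a
  induction a using LeavittPathAlgebra.induction with
  | algebraMap k => exact fun x hx => by simpa only [← Algebra.smul_def] using W.smul_mem k hx
  | of g => exact hmul g
  | mul a b ha hb => exact fun x hx => mul_assoc a b x ▸ ha _ (hb x hx)
  | add a b ha hb => exact fun x hx => add_mul a b x ▸ W.add_mem (ha x hx) (hb x hx)

section Relations

theorem ghost_mul_edge [DecidableEq E] (e f : E) :
    T e * S f = if e = f then P (G.r e) else 0 := by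
  split_ifs with h
  · exact h ▸ (isFamily K G).ghost_mul_edge_self e
  · exact (isFamily K G).ghost_mul_edge_of_ne e f h

variable [DecidableEq V]

theorem vertex_mul_vertex (v w : V) : P v * P w = if v = w then P v else 0 := by
  split_ifs with h
  · exact h ▸ (isFamily K G).vertex_mul_self v
  · exact (isFamily K G).vertex_mul_of_ne v w h

theorem vertex_mul_edge (v : V) (e : E) : P v * S e = if v = G.s e then S e else 0 := by
  rw [← (isFamily K G).source_mul_edge e, ← mul_assoc, vertex_mul_vertex]
  split_ifs with h <;> simp [h]

theorem edge_mul_vertex (e : E) (v : V) : S e * P v = if G.r e = v then S e else 0 := by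
  rw [← (isFamily K G).edge_mul_range e, mul_assoc, vertex_mul_vertex]
  split_ifs with h <;> simp

theorem ghost_mul_vertex (e : E) (v : V) : T e * P v = if G.s e = v then T e else 0 := by
  rw [← (isFamily K G).ghost_mul_source e, mul_assoc, vertex_mul_vertex]
  split_ifs with h <;> simp

end Relations

omit [Fintype V] in
theorem exists_equiv_fst_eq_source (hreg : ∀ v, G.IsRegular v) :
    ∃ φ : E × ℕ ≃ V × ℕ, ∀ e n, (φ (e, n)).1 = G.s e := by
  have h : ∀ v, Nonempty ({e // G.s e = v} × ℕ ≃ ℕ) := fun v => by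
    have : Nonempty {e // G.s e = v} := (hreg v).2.to_subtype
    have : Finite {e // G.s e = v} := (hreg v).1
    exact nonempty_equiv_of_countable
  let φ : E × ℕ ≃ V × ℕ :=
    (((Equiv.sigmaFiberEquiv G.s).symm.prodCongr (Equiv.refl ℕ)).trans
      (Equiv.sigmaProdDistrib _ _)).trans
        ((Equiv.sigmaCongrRight fun v => (h v).some).trans (Equiv.sigmaEquivProd V ℕ))
  exact ⟨φ, fun e n => rfl⟩

omit [Fintype V] in
theorem exists_isFamily_vertex_ne_zero (hreg : ∀ v, G.IsRegular v) :
    ∃ (p : V → Module.End K (V × ℕ → K)) (s t : E → Module.End K (V × ℕ → K)),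
      IsFamily G p s t ∧ ∀ v, p v ≠ 0 := by
  classical
  obtain ⟨φ, hφ⟩ := exists_equiv_fst_eq_source hreg
  have hφsymm (x : V × ℕ) : G.s (φ.symm x).1 = x.1 := by
    rw [← hφ _ (φ.symm x).2, Prod.mk.eta, φ.apply_symm_apply]
  let p (v : V) : Module.End K (V × ℕ → K) :=
    { toFun := fun ξ x => if x.1 = v then ξ x else 0
      map_add' := fun ξ η => by ext; simp [ite_add_zero]
      map_smul' := fun k ξ => by ext; simp }
  let s (e : E) : Module.End K (V × ℕ → K) :=
    { toFun := fun ξ x => if (φ.symm x).1 = e then ξ (G.r e, (φ.symm x).2) else 0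
      map_add' := fun ξ η => by ext; simp [ite_add_zero]
      map_smul' := fun k ξ => by ext; simp }
  let t (e : E) : Module.End K (V × ℕ → K) :=
    { toFun := fun ξ x => if x.1 = G.r e then ξ (φ (e, x.2)) else 0
      map_add' := fun ξ η => by ext; simp [ite_add_zero]
      map_smul' := fun k ξ => by ext; simp }
  have hp (v ξ x) : p v ξ x = if x.1 = v then ξ x else 0 := rfl
  have hs (e ξ x) : s e ξ x = if (φ.symm x).1 = e then ξ (G.r e, (φ.symm x).2) else 0 := rfl
  have ht (e ξ x) : t e ξ x = if x.1 = G.r e then ξ (φ (e, x.2)) else 0 := rfl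
  have hF : IsFamily G p s t := by
    constructor <;> intros <;> ext ξ x
    case vertex_eq_sum v hv =>
      simp only [LinearMap.sum_apply, Finset.sum_apply, Module.End.mul_apply, hp, hs, ht, if_pos,
        Finset.sum_ite_eq, Set.Finite.mem_toFinset, Set.mem_ofPred_eq, hφsymm, Prod.mk.eta,
        φ.apply_symm_apply]
    all_goals
      simp only [Module.End.mul_apply, LinearMap.zero_apply, Pi.zero_apply, hp, hs, ht]
      grind
  refine ⟨p, s, t, hF, fun v hv => ?_⟩
  simpa [hp] using congrFun (LinearMap.congr_fun hv fun _ => 1) (v, 0)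

theorem vertex_ne_zero (hreg : ∀ v, G.IsRegular v) (v : V) : P v ≠ 0 := by
  obtain ⟨p, s, t, hF, hp⟩ := exists_isFamily_vertex_ne_zero (K := K) hreg
  obtain ⟨F, ⟨hFv, -, -⟩, -⟩ := existsUnique_lift K G hF
  exact fun hv => hp v (by rw [← hFv, hv, map_zero])

theorem exists_mul_vertex_ne_zero {x : LeavittPathAlgebra K G} (hx : x ≠ 0) :
    ∃ v, x * P v ≠ 0 := by
  by_contra! h
  exact hx (by rw [← mul_one x, ← sum_vertex, Finset.mul_sum, Finset.sum_eq_zero fun v _ => h v])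

theorem exists_vertex_mul_ne_zero {x : LeavittPathAlgebra K G} (hx : x ≠ 0) :
    ∃ v, P v * x ≠ 0 := by
  by_contra! h
  exact hx (by rw [← one_mul x, ← sum_vertex, Finset.sum_mul, Finset.sum_eq_zero fun v _ => h v])

theorem exists_mul_edge_ne_zero (hreg : ∀ v, G.IsRegular v) {x : LeavittPathAlgebra K G}
    (hx : x ≠ 0) : ∃ e, x * S e ≠ 0 := by
  obtain ⟨v, hv⟩ := exists_mul_vertex_ne_zero hx
  by_contra! h
  refine hv ?_
  rw [(isFamily K G).vertex_eq_sum v (hreg v), Finset.mul_sum]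
  exact Finset.sum_eq_zero fun e _ => by rw [← mul_assoc, h, zero_mul]

theorem exists_ghost_mul_ne_zero (hreg : ∀ v, G.IsRegular v) {x : LeavittPathAlgebra K G}
    (hx : x ≠ 0) : ∃ e, T e * x ≠ 0 := by
  obtain ⟨v, hv⟩ := exists_vertex_mul_ne_zero hx
  by_contra! h
  refine hv ?_
  rw [(isFamily K G).vertex_eq_sum v (hreg v), Finset.sum_mul]
  exact Finset.sum_eq_zero fun e _ => by rw [mul_assoc, h, mul_zero]

variable (K G) in
/-- The product in `L_K(G)` of the edges in a list; it is zero unless consecutive edges are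
composable, and it is `1` for the empty list. -/
def edgeProd (α : List E) : LeavittPathAlgebra K G :=
  (α.map fun e => S e).prod

@[simp]
theorem edgeProd_nil : edgeProd K G [] = 1 := rfl

theorem edgeProd_cons (e : E) (α : List E) : edgeProd K G (e :: α) = S e * edgeProd K G α := by
  rw [edgeProd, List.map_cons, List.prod_cons, edgeProd]

theorem edgeProd_append (α β : List E) :
    edgeProd K G (α ++ β) = edgeProd K G α * edgeProd K G β := by
  rw [edgeProd, List.map_append, List.prod_append, edgeProd, edgeProd]

theorem exists_mul_edgeProd_ne_zero (hreg : ∀ v, G.IsRegular v) {x : LeavittPathAlgebra K G}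
    (hx : x ≠ 0) (n : ℕ) : ∃ α : List E, α.length = n ∧ x * edgeProd K G α ≠ 0 := by
  induction n with
  | zero => exact ⟨[], rfl, by rwa [edgeProd_nil, mul_one]⟩
  | succ n ih =>
    obtain ⟨α, rfl, hα⟩ := ih
    obtain ⟨e, he⟩ := exists_mul_edge_ne_zero hreg hα
    exact ⟨α ++ [e], by simp, by simpa [edgeProd_append, edgeProd_cons, mul_assoc] using he⟩

theorem vertex_mul_edgeProd_eq_or (v : V) {α : List E} (hα : α ≠ []) :
    P v * edgeProd K G α = edgeProd K G α ∨ P v * edgeProd K G α = 0 := by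
  classical
  obtain ⟨e, β, rfl⟩ := List.exists_cons_of_ne_nil hα
  rw [edgeProd_cons, ← mul_assoc, vertex_mul_edge]
  split_ifs <;> simp

theorem edgeProd_mul_vertex_eq_or (v : V) {α : List E} (hα : α ≠ []) :
    edgeProd K G α * P v = edgeProd K G α ∨ edgeProd K G α * P v = 0 := by
  classical
  obtain ⟨β, e, rfl⟩ := List.eq_nil_or_concat' α |>.resolve_left hα
  rw [edgeProd_append, edgeProd_cons, edgeProd_nil, mul_one, mul_assoc, edge_mul_vertex]
  split_ifs <;> simp

variable (K G) in
/-- The span of the vertices. -/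
def vertexSpan : Submodule K (LeavittPathAlgebra K G) :=
  Submodule.span K (Set.range fun v => P v)

variable (K G) in
/-- The span of the paths of positive length at most `N`. -/
def pathSpan (N : ℕ) : Submodule K (LeavittPathAlgebra K G) :=
  Submodule.span K {x | ∃ α : List E, α ≠ [] ∧ α.length ≤ N ∧ edgeProd K G α = x}

theorem vertex_mem_vertexSpan (v : V) : P v ∈ vertexSpan K G :=
  Submodule.subset_span ⟨v, rfl⟩

theorem edgeProd_mem_pathSpan {α : List E} (hα : α ≠ []) {N : ℕ} (hN : α.length ≤ N) :
    edgeProd K G α ∈ pathSpan K G N :=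
  Submodule.subset_span ⟨α, hα, hN, rfl⟩

theorem pathSpan_mono : Monotone (pathSpan K G) := fun _ _ hMN =>
  Submodule.span_mono fun _ ⟨α, hα, hM, hx⟩ => ⟨α, hα, hM.trans hMN, hx⟩

theorem pathSpan_zero : pathSpan K G 0 = ⊥ := by
  refine Submodule.span_eq_bot.2 ?_
  rintro _ ⟨α, hα, hlen, -⟩
  exact absurd (List.length_eq_zero_iff.1 (Nat.le_zero.1 hlen)) hα

theorem vertex_mul_mul_vertex_mem_pathSpan (v w : V) {N : ℕ} {x : LeavittPathAlgebra K G}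
    (hx : x ∈ pathSpan K G N) : P v * x * P w ∈ pathSpan K G N := by
  suffices h : pathSpan K G N ≤
      (pathSpan K G N).comap (LinearMap.mulLeftRight K (P v, P w)) from h hx
  refine Submodule.span_le.2 ?_
  rintro _ ⟨α, hα, hN, rfl⟩
  change P v * edgeProd K G α * P w ∈ pathSpan K G N
  rcases vertex_mul_edgeProd_eq_or (K := K) (G := G) v hα with h | h <;> rw [h]
  · rcases edgeProd_mul_vertex_eq_or (K := K) (G := G) w hα with h | h <;> rw [h]
    · exact edgeProd_mem_pathSpan hα hN
    · exact zero_mem _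
  · simp

theorem ghost_mul_mem_of_mem_pathSpan (e : E) {N : ℕ} {x : LeavittPathAlgebra K G}
    (hx : x ∈ pathSpan K G (N + 1)) : T e * x ∈ vertexSpan K G ⊔ pathSpan K G N := by
  classical
  suffices h : pathSpan K G (N + 1) ≤
      (vertexSpan K G ⊔ pathSpan K G N).comap (LinearMap.mulLeft K (T e)) from h hx
  refine Submodule.span_le.2 ?_
  rintro _ ⟨α, hα, hN, rfl⟩
  obtain ⟨f, β, rfl⟩ := List.exists_cons_of_ne_nil hα
  change T e * edgeProd K G (f :: β) ∈ vertexSpan K G ⊔ pathSpan K G N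
  rw [edgeProd_cons, ← mul_assoc, ghost_mul_edge]
  split_ifs
  · obtain rfl | hβ := eq_or_ne β []
    · rw [edgeProd_nil, mul_one]
      exact Submodule.mem_sup_left (vertex_mem_vertexSpan _)
    · rcases vertex_mul_edgeProd_eq_or (K := K) (G := G) (G.r e) hβ with h | h <;> rw [h]
      · exact Submodule.mem_sup_right (edgeProd_mem_pathSpan hβ (by simpa using hN))
      · exact zero_mem _
  · rw [zero_mul]
    exact zero_mem _

theorem exists_vertex_mul_mul_vertex_eq_smul {c : LeavittPathAlgebra K G}
    (hc : c ∈ vertexSpan K G) (hc0 : c ≠ 0) : ∃ v, ∃ k : K, k ≠ 0 ∧ P v * c * P v = k • P v := by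
  classical
  obtain ⟨k, rfl⟩ := (Submodule.mem_span_range_iff_exists_fun K).1 hc
  obtain ⟨v, -, hv⟩ := Finset.exists_ne_zero_of_sum_ne_zero hc0
  refine ⟨v, k v, (smul_ne_zero_iff.1 hv).1, ?_⟩
  simp [Finset.mul_sum, vertex_mul_vertex]

theorem exists_mul_mul_eq_vertex_add_of_mem_vertexSpan {N : ℕ} {c z : LeavittPathAlgebra K G}
    (hc : c ∈ vertexSpan K G) (hc0 : c ≠ 0) (hz : z ∈ pathSpan K G N) :
    ∃ a b v, ∃ z' ∈ pathSpan K G N, a * (c + z) * b = P v + z' := by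
  obtain ⟨v, k, hk, hv⟩ := exists_vertex_mul_mul_vertex_eq_smul hc hc0
  refine ⟨k⁻¹ • P v, P v, v, k⁻¹ • (P v * z * P v),
    Submodule.smul_mem _ _ (vertex_mul_mul_vertex_mem_pathSpan v v hz), ?_⟩
  rw [smul_mul_assoc, smul_mul_assoc, mul_add, add_mul, hv, smul_add, inv_smul_smul₀ hk]

/-- Multiplication by ghost edges shortens the paths in `y` until a vertex appears. -/
theorem exists_mul_mul_eq_vertex_add (hreg : ∀ v, G.IsRegular v) {N : ℕ}
    {y : LeavittPathAlgebra K G} (hy : y ∈ vertexSpan K G ⊔ pathSpan K G N) (hy0 : y ≠ 0) :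
    ∃ a b v, ∃ z ∈ pathSpan K G N, a * y * b = P v + z := by
  induction N generalizing y with
  | zero =>
    rw [pathSpan_zero, sup_bot_eq] at hy
    simpa using exists_mul_mul_eq_vertex_add_of_mem_vertexSpan hy hy0
      (zero_mem (pathSpan K G 0))
  | succ N ih =>
    obtain ⟨c, hc, z, hz, rfl⟩ := Submodule.mem_sup.1 hy
    obtain rfl | hc0 := eq_or_ne c 0
    · rw [zero_add] at hy0 ⊢
      obtain ⟨e, he⟩ := exists_ghost_mul_ne_zero hreg hy0
      obtain ⟨a, b, v, z', hz', h⟩ := ih (ghost_mul_mem_of_mem_pathSpan e hz) he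
      exact ⟨a * T e, b, v, z', pathSpan_mono N.le_succ hz', by rw [← h]; simp only [mul_assoc]⟩
    · exact exists_mul_mul_eq_vertex_add_of_mem_vertexSpan hc hc0 hz

theorem vertex_mul_mem_sup (v : V) {N : ℕ} {x : LeavittPathAlgebra K G}
    (hx : x ∈ vertexSpan K G ⊔ pathSpan K G N) : P v * x ∈ vertexSpan K G ⊔ pathSpan K G N := by
  classical
  suffices h : vertexSpan K G ⊔ pathSpan K G N ≤
      (vertexSpan K G ⊔ pathSpan K G N).comap (LinearMap.mulLeft K (P v)) from h hx
  refine sup_le (Submodule.span_le.2 ?_) (Submodule.span_le.2 ?_)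
  · rintro _ ⟨w, rfl⟩
    change P v * P w ∈ vertexSpan K G ⊔ pathSpan K G N
    rw [vertex_mul_vertex]
    split_ifs
    · exact Submodule.mem_sup_left (vertex_mem_vertexSpan v)
    · exact zero_mem _
  · rintro _ ⟨α, hα, hN, rfl⟩
    change P v * edgeProd K G α ∈ vertexSpan K G ⊔ pathSpan K G N
    rcases vertex_mul_edgeProd_eq_or (K := K) (G := G) v hα with h | h <;> rw [h]
    · exact Submodule.mem_sup_right (edgeProd_mem_pathSpan hα hN)
    · exact zero_mem _

theorem edge_mul_mem_pathSpan (e : E) {N : ℕ} {x : LeavittPathAlgebra K G}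
    (hx : x ∈ vertexSpan K G ⊔ pathSpan K G N) : S e * x ∈ pathSpan K G (N + 1) := by
  classical
  suffices h : vertexSpan K G ⊔ pathSpan K G N ≤
      (pathSpan K G (N + 1)).comap (LinearMap.mulLeft K (S e)) from h hx
  refine sup_le (Submodule.span_le.2 ?_) (Submodule.span_le.2 ?_)
  · rintro _ ⟨v, rfl⟩
    change S e * P v ∈ pathSpan K G (N + 1)
    rw [edge_mul_vertex]
    split_ifs
    · exact Submodule.subset_span ⟨[e], by simp, by simp, by simp [edgeProd_cons]⟩
    · exact zero_mem _
  · rintro _ ⟨α, -, hN, rfl⟩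
    exact Submodule.subset_span ⟨e :: α, by simp, by simpa using hN, edgeProd_cons e α⟩

theorem mul_edge_mem_pathSpan (e : E) {N : ℕ} {x : LeavittPathAlgebra K G}
    (hx : x ∈ vertexSpan K G ⊔ pathSpan K G N) : x * S e ∈ pathSpan K G (N + 1) := by
  classical
  suffices h : vertexSpan K G ⊔ pathSpan K G N ≤
      (pathSpan K G (N + 1)).comap (LinearMap.mulRight K (S e)) from h hx
  refine sup_le (Submodule.span_le.2 ?_) (Submodule.span_le.2 ?_)
  · rintro _ ⟨v, rfl⟩
    change P v * S e ∈ pathSpan K G (N + 1)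
    rw [vertex_mul_edge]
    split_ifs
    · exact Submodule.subset_span ⟨[e], by simp, by simp, by simp [edgeProd_cons]⟩
    · exact zero_mem _
  · rintro _ ⟨α, -, hN, rfl⟩
    exact Submodule.subset_span
      ⟨α ++ [e], by simp, by simpa using hN, by simp [edgeProd_append, edgeProd_cons]⟩

theorem exists_ghost_mul_mul_edgeProd_mem_sup (e : E) {n : ℕ} {x : LeavittPathAlgebra K G}
    (hx : ∀ α : List E, α.length = n →
      ∃ N, x * edgeProd K G α ∈ vertexSpan K G ⊔ pathSpan K G N)
    {α : List E} (hα : α.length = n + 1) :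
    ∃ N, T e * x * edgeProd K G α ∈ vertexSpan K G ⊔ pathSpan K G N := by
  obtain rfl | ⟨β, f, rfl⟩ := List.eq_nil_or_concat' α
  · simp at hα
  · obtain ⟨N, hN⟩ := hx β (by simpa using hα)
    refine ⟨N, ?_⟩
    rw [edgeProd_append, edgeProd_cons, edgeProd_nil, mul_one, mul_assoc, ← mul_assoc x]
    exact ghost_mul_mem_of_mem_pathSpan e (mul_edge_mem_pathSpan f hN)

theorem eventually_mul_edgeProd_mem_sup (x : LeavittPathAlgebra K G) :
    ∀ᶠ n in Filter.atTop, ∀ α : List E, α.length = n →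
      ∃ N, x * edgeProd K G α ∈ vertexSpan K G ⊔ pathSpan K G N := by
  let W : Submodule K (LeavittPathAlgebra K G) :=
    { carrier := {x | ∀ᶠ n in Filter.atTop, ∀ α : List E, α.length = n →
        ∃ N, x * edgeProd K G α ∈ vertexSpan K G ⊔ pathSpan K G N}
      add_mem' := fun hx hy => by
        filter_upwards [hx, hy] with n hx hy α hα
        obtain ⟨M, hM⟩ := hx α hα
        obtain ⟨N, hN⟩ := hy α hα
        exact ⟨max M N, add_mul _ _ (edgeProd K G α) ▸ add_mem
          (sup_le_sup_left (pathSpan_mono (le_max_left M N)) _ hM)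
          (sup_le_sup_left (pathSpan_mono (le_max_right M N)) _ hN)⟩
      zero_mem' := .of_forall fun n α _ => ⟨0, by simp⟩
      smul_mem' := fun k x hx => hx.mono fun n hx α hα => (hx α hα).imp fun N hN => by
        rw [smul_mul_assoc]; exact Submodule.smul_mem _ k hN }
  suffices h : W = ⊤ from (h ▸ Submodule.mem_top : x ∈ W)
  refine submodule_eq_top_of_of_mul_mem ?_ ?_
  · filter_upwards [Filter.eventually_gt_atTop 0] with n hn α hα
    exact ⟨n, (one_mul (edgeProd K G α)).symm ▸ Submodule.mem_sup_right
      (edgeProd_mem_pathSpan (List.length_pos_iff.1 (hα ▸ hn)) hα.le)⟩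
  rintro (v | e | e) x hx
  · exact hx.mono fun n hx α hα => (hx α hα).imp fun N hN =>
      mul_assoc (P v) x _ ▸ vertex_mul_mem_sup v hN
  · refine hx.mono fun n hx α hα => ?_
    obtain ⟨N, hN⟩ := hx α hα
    exact ⟨N + 1, mul_assoc (S e) x _ ▸ Submodule.mem_sup_right (edge_mul_mem_pathSpan e hN)⟩
  · obtain ⟨M, hM⟩ := Filter.eventually_atTop.1 hx
    refine Filter.eventually_atTop.2 ⟨M + 1, fun n hn α hα => ?_⟩
    obtain ⟨n, rfl⟩ := Nat.exists_eq_add_of_lt hn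
    exact exists_ghost_mul_mul_edgeProd_mem_sup e (hM (M + n) (by omega)) (by omega)

theorem ghost_mul_ghost_pow_mul_edgeProd_eq_zero {e f : E} {n : ℕ} {α : List E}
    (hn : n < α.length) (hf : f ≠ α[n]) : T f * (T e) ^ n * edgeProd K G α = 0 := by
  classical
  induction n generalizing α with
  | zero =>
    obtain ⟨g, β, rfl⟩ := List.exists_cons_of_length_pos hn
    rw [pow_zero, mul_one, edgeProd_cons, ← mul_assoc, ghost_mul_edge,
      if_neg (by simpa using hf), zero_mul]
  | succ n ih =>
    obtain ⟨g, β, rfl⟩ := List.exists_cons_of_length_pos (Nat.zero_lt_of_lt hn)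
    have hβ : n < β.length := by simpa using hn
    rw [pow_succ, edgeProd_cons, ← mul_assoc, ← mul_assoc, mul_assoc _ (T e), ghost_mul_edge]
    split_ifs
    · rw [mul_assoc]
      rcases vertex_mul_edgeProd_eq_or (K := K) (G := G) (G.r e)
        (List.length_pos_iff.1 (Nat.zero_lt_of_lt hβ)) with h | h <;> rw [h]
      · exact ih hβ (by simpa using hf)
      · exact mul_zero _
    · rw [mul_zero, zero_mul]

theorem ghost_mul_ghost_pow_mul_mul_edgeProd_replicate_eq_zero {e f : E} (hef : e ≠ f) {N : ℕ}
    {z : LeavittPathAlgebra K G} (hz : z ∈ pathSpan K G N) :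
    T f * (T e) ^ N * z * edgeProd K G (List.replicate N e) = 0 := by
  suffices h : pathSpan K G N ≤ LinearMap.ker
      (LinearMap.mulLeftRight K (T f * (T e) ^ N, edgeProd K G (List.replicate N e))) from h hz
  refine Submodule.span_le.2 ?_
  rintro _ ⟨α, hα, hN, rfl⟩
  change T f * (T e) ^ N * edgeProd K G α * edgeProd K G (List.replicate N e) = 0
  have hpos := List.length_pos_iff.2 hα
  rw [mul_assoc, ← edgeProd_append]
  refine ghost_mul_ghost_pow_mul_edgeProd_eq_zero (by simpa using hpos) ?_
  rw [List.getElem_append_right hN, List.getElem_replicate]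
  exact hef.symm

theorem ghost_mul_vertex_mul_edge (e : E) : T e * P (G.s e) * S e = P (G.r e) := by
  rw [(isFamily K G).ghost_mul_source, (isFamily K G).ghost_mul_edge_self]

theorem ghost_pow_mul_vertex_mul_edgeProd_replicate {e : E} (he : G.s e = G.r e) (n : ℕ) :
    (T e) ^ n * P (G.s e) * edgeProd K G (List.replicate n e) = P (G.s e) := by
  induction n with
  | zero => simp
  | succ n ih =>
    rw [pow_succ, List.replicate_succ, edgeProd_cons, ← mul_assoc, mul_assoc _ (T e),
      mul_assoc _ _ (S e), ghost_mul_vertex_mul_edge, ← he, ih]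

/-- Left multiplication by `f* (e*)ᴺ` kills all paths but those that start with `eᴺ f`. Right
multiplication by `eᴺ f` takes `v` to such a path, but none of the paths of positive length at most
`N`. -/
theorem exists_mul_vertex_add_mul_eq_vertex {e f : E} (hef : e ≠ f) (he : G.s e = G.r e)
    (hf : G.s f = G.s e) {N : ℕ} {z : LeavittPathAlgebra K G} (hz : z ∈ pathSpan K G N) :
    ∃ a b, a * (P (G.s e) + z) * b = P (G.r f) := by
  refine ⟨T f * (T e) ^ N, edgeProd K G (List.replicate N e) * S f, ?_⟩
  rw [← mul_assoc, mul_add, add_mul,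
    ghost_mul_ghost_pow_mul_mul_edgeProd_replicate_eq_zero hef hz, add_zero, mul_assoc (T f),
    mul_assoc (T f), ghost_pow_mul_vertex_mul_edgeProd_replicate he, ← hf,
    ghost_mul_vertex_mul_edge]

theorem exists_mul_mul_eq_vertex (hreg : ∀ v, G.IsRegular v)
    (hloop : ∀ v, ∃ e f, e ≠ f ∧ G.s e = v ∧ G.r e = v ∧ G.s f = v) {x : LeavittPathAlgebra K G}
    (hx : x ≠ 0) : ∃ a b v, a * x * b = P v := by
  obtain ⟨n, hn⟩ := (eventually_mul_edgeProd_mem_sup x).exists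
  obtain ⟨α, hα, hα0⟩ := exists_mul_edgeProd_ne_zero hreg hx n
  obtain ⟨N, hN⟩ := hn α hα
  obtain ⟨a, b, v, z, hz, hab⟩ := exists_mul_mul_eq_vertex_add hreg hN hα0
  obtain ⟨e, f, hef, rfl, he, hf⟩ := hloop v
  obtain ⟨a', b', h⟩ := exists_mul_vertex_add_mul_eq_vertex hef he.symm hf hz
  exact ⟨a' * a, edgeProd K G α * b * b', G.r f, by rw [← h, ← hab]; simp only [mul_assoc]⟩

theorem vertex_mem_of_reflTransGen {I : TwoSidedIdeal (LeavittPathAlgebra K G)} {v w : V}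
    (hvw : Relation.ReflTransGen (fun v w => ∃ e, G.s e = v ∧ G.r e = w) v w)
    (hv : P v ∈ I) : P w ∈ I := by
  induction hvw with
  | refl => exact hv
  | tail _ he ih =>
    obtain ⟨e, rfl, rfl⟩ := he
    exact ghost_mul_vertex_mul_edge (K := K) (G := G) e ▸
      I.mul_mem_right _ _ (I.mul_mem_left _ _ ih)

theorem isSimpleRing [Nonempty V] (hreg : ∀ v, G.IsRegular v)
    (hloop : ∀ v, ∃ e f, e ≠ f ∧ G.s e = v ∧ G.r e = v ∧ G.s f = v)
    (hconn : ∀ v w, Relation.ReflTransGen (fun v w => ∃ e, G.s e = v ∧ G.r e = w) v w) :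
    IsSimpleRing (LeavittPathAlgebra K G) := by
  have : Nontrivial (LeavittPathAlgebra K G) :=
    nontrivial_of_ne (P (Classical.arbitrary V)) 0 (vertex_ne_zero hreg _)
  refine .of_eq_bot_or_eq_top fun I => or_iff_not_imp_left.2 fun hI => ?_
  obtain ⟨x, hxI, hx⟩ : ∃ x ∈ I, x ≠ 0 := by
    by_contra! h
    exact hI (eq_bot_iff.2 fun x hx => (TwoSidedIdeal.mem_bot _).2 (h x hx))
  obtain ⟨a, b, v, hv⟩ := exists_mul_mul_eq_vertex hreg hloop hx
  have hvI : P v ∈ I := hv ▸ I.mul_mem_right _ _ (I.mul_mem_left _ _ hxI)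
  exact I.one_mem_iff.1 (sum_vertex K G ▸
    sum_mem fun w _ => vertex_mem_of_reflTransGen (hconn v w) hvI)

variable (K G) in
/-- The product `e_n* ⋯ e_1*` in `L_K(G)` of the ghost edges of a list `[e_n, …, e_1]`. -/
def ghostProd (β : List E) : LeavittPathAlgebra K G :=
  (β.map fun e => T e).prod

@[simp]
theorem ghostProd_nil : ghostProd K G [] = 1 := rfl

theorem ghostProd_cons (e : E) (β : List E) : ghostProd K G (e :: β) = T e * ghostProd K G β := by
  rw [ghostProd, List.map_cons, List.prod_cons, ghostProd]

theorem ghostProd_append (α β : List E) :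
    ghostProd K G (α ++ β) = ghostProd K G α * ghostProd K G β := by
  rw [ghostProd, List.map_append, List.prod_append, ghostProd, ghostProd]

variable (K G) in
/-- The span of the products of an edge list and a ghost edge list. -/
def monomialSpan : Submodule K (LeavittPathAlgebra K G) :=
  Submodule.span K {x | ∃ α β : List E, edgeProd K G α * ghostProd K G β = x}

theorem edgeProd_mul_ghostProd_mem_monomialSpan (α β : List E) :
    edgeProd K G α * ghostProd K G β ∈ monomialSpan K G :=
  Submodule.subset_span ⟨α, β, rfl⟩

theorem vertex_mul_edgeProd_mul_ghostProd_mem_monomialSpan (hreg : ∀ v, G.IsRegular v) (v : V)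
    (α β : List E) : P v * (edgeProd K G α * ghostProd K G β) ∈ monomialSpan K G := by
  obtain rfl | hα := eq_or_ne α []
  · rw [(isFamily K G).vertex_eq_sum v (hreg v), edgeProd_nil, one_mul, Finset.sum_mul]
    refine sum_mem fun e _ => Submodule.subset_span ⟨[e], e :: β, ?_⟩
    rw [edgeProd_cons, edgeProd_nil, mul_one, ghostProd_cons, mul_assoc]
  · rw [← mul_assoc]
    rcases vertex_mul_edgeProd_eq_or (K := K) (G := G) v hα with h | h <;> rw [h]
    · exact edgeProd_mul_ghostProd_mem_monomialSpan α β
    · rw [zero_mul]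
      exact zero_mem _

theorem ghost_mul_edgeProd_mul_ghostProd_mem_monomialSpan (hreg : ∀ v, G.IsRegular v) (e : E)
    (α β : List E) : T e * (edgeProd K G α * ghostProd K G β) ∈ monomialSpan K G := by
  classical
  cases α with
  | nil => exact Submodule.subset_span ⟨[], e :: β, by simp [ghostProd_cons]⟩
  | cons f α =>
    rw [edgeProd_cons, mul_assoc, ← mul_assoc, ghost_mul_edge]
    split_ifs
    · exact vertex_mul_edgeProd_mul_ghostProd_mem_monomialSpan hreg _ α β
    · rw [zero_mul]
      exact zero_mem _

theorem monomialSpan_eq_top (hreg : ∀ v, G.IsRegular v) : monomialSpan K G = ⊤ := by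
  refine submodule_eq_top_of_of_mul_mem (Submodule.subset_span ⟨[], [], by simp⟩)
    fun g x hx => ?_
  suffices h : monomialSpan K G ≤
      (monomialSpan K G).comap (LinearMap.mulLeft K (of K G g)) from h hx
  refine Submodule.span_le.2 ?_
  rintro _ ⟨α, β, rfl⟩
  change of K G g * (edgeProd K G α * ghostProd K G β) ∈ monomialSpan K G
  cases g with
  | vertex v => exact vertex_mul_edgeProd_mul_ghostProd_mem_monomialSpan hreg v α β
  | edge e => exact Submodule.subset_span ⟨e :: α, β, by rw [edgeProd_cons, mul_assoc]⟩
  | ghost e => exact ghost_mul_edgeProd_mul_ghostProd_mem_monomialSpan hreg e α β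

section Grading

variable (K G) in
theorem isFamily_single :
    IsFamily G (fun v => AddMonoidAlgebra.single (0 : ℤ) (P v))
      (fun e => AddMonoidAlgebra.single (1 : ℤ) (S e))
      (fun e => AddMonoidAlgebra.single (-1 : ℤ) (T e)) := by
  have h := isFamily K G
  constructor <;> intros <;> simp only [AddMonoidAlgebra.single_mul_single]
  case vertex_eq_sum v hv =>
    simp only [h.vertex_eq_sum v hv, add_neg_cancel]
    exact map_sum (AddMonoidAlgebra.singleAddHom 0) _ _
  all_goals simp_all [h.vertex_mul_self, h.vertex_mul_of_ne, h.source_mul_edge, h.edge_mul_range,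
    h.range_mul_ghost, h.ghost_mul_source, h.ghost_mul_edge_self, h.ghost_mul_edge_of_ne]

variable (K G) in
/-- The grading of `L_K(G)` by path length, in which a ghost edge has degree `-1`. An element `x`
that is homogeneous of degree `d` is mapped to the monomial `single d x`. -/
noncomputable def grading : LeavittPathAlgebra K G →ₙₐ[K]
    AddMonoidAlgebra (LeavittPathAlgebra K G) ℤ :=
  (existsUnique_lift K G (isFamily_single K G)).choose

variable (G) in
/-- `x` is homogeneous of degree `d` for the path length. -/
def IsHomogeneous (x : LeavittPathAlgebra K G) (d : ℤ) : Prop :=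
  grading K G x = AddMonoidAlgebra.single d x

theorem isHomogeneous_vertex (v : V) : IsHomogeneous G (P v) 0 :=
  (existsUnique_lift K G (isFamily_single K G)).choose_spec.1.1 v

theorem isHomogeneous_edge (e : E) : IsHomogeneous G (S e) 1 :=
  (existsUnique_lift K G (isFamily_single K G)).choose_spec.1.2.1 e

theorem isHomogeneous_ghost (e : E) : IsHomogeneous G (T e) (-1) :=
  (existsUnique_lift K G (isFamily_single K G)).choose_spec.1.2.2 e

theorem isHomogeneous_sum {ι : Type*} {s : Finset ι} {x : ι → LeavittPathAlgebra K G} {d : ℤ}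
    (h : ∀ i ∈ s, IsHomogeneous G (x i) d) : IsHomogeneous G (∑ i ∈ s, x i) d := by
  rw [IsHomogeneous, map_sum, Finset.sum_congr rfl h]
  exact (map_sum (AddMonoidAlgebra.singleAddHom d) _ _).symm

theorem isHomogeneous_one : IsHomogeneous G (1 : LeavittPathAlgebra K G) 0 :=
  sum_vertex K G ▸ isHomogeneous_sum fun v _ => isHomogeneous_vertex v

theorem IsHomogeneous.mul {x y : LeavittPathAlgebra K G} {c d : ℤ} (hx : IsHomogeneous G x c)
    (hy : IsHomogeneous G y d) : IsHomogeneous G (x * y) (c + d) := by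
  rw [IsHomogeneous, map_mul, hx, hy, AddMonoidAlgebra.single_mul_single]

theorem isHomogeneous_edgeProd (α : List E) : IsHomogeneous G (edgeProd K G α) α.length := by
  induction α with
  | nil => exact isHomogeneous_one
  | cons e α ih =>
    rw [edgeProd_cons, List.length_cons, Nat.cast_succ, add_comm]
    exact (isHomogeneous_edge e).mul ih

theorem isHomogeneous_ghostProd (β : List E) : IsHomogeneous G (ghostProd K G β) (-β.length) := by
  induction β with
  | nil => exact isHomogeneous_one
  | cons e β ih =>
    rw [ghostProd_cons, List.length_cons, Nat.cast_succ, neg_add_rev]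
    exact (isHomogeneous_ghost e).mul ih

theorem exists_linearMap_vertex_eq (hreg : ∀ v, G.IsRegular v) (ε : V → K) :
    ∃ f : LeavittPathAlgebra K G →ₗ[K] K, ∀ v, f (P v) = ε v := by
  classical
  choose f hf using fun v =>
    Module.Projective.exists_dual_eq_one K (vertex_ne_zero (K := K) hreg v)
  refine ⟨∑ v, ε v • (f v ∘ₗ LinearMap.mulLeft K (P v)), fun v => ?_⟩
  simp [vertex_mul_vertex, apply_ite, hf]

theorem exists_linearMap_vertex_eq_and_isHomogeneous_eq_zero (hreg : ∀ v, G.IsRegular v)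
    (ε : V → K) : ∃ t : LeavittPathAlgebra K G →ₗ[K] K,
      (∀ v, t (P v) = ε v) ∧ ∀ x d, IsHomogeneous G x d → d ≠ 0 → t x = 0 := by
  obtain ⟨f, hf⟩ := exists_linearMap_vertex_eq hreg ε
  let coeffZero : AddMonoidAlgebra (LeavittPathAlgebra K G) ℤ →ₗ[K] LeavittPathAlgebra K G :=
    { toFun := fun x => x.coeff 0
      map_add' := fun _ _ => rfl
      map_smul' := fun _ _ => rfl }
  have hcoeff {x d} (hx : IsHomogeneous G x d) :
      coeffZero (grading K G x) = Finsupp.single d x 0 := by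
    rw [hx]; rfl
  refine ⟨f ∘ₗ coeffZero ∘ₗ (grading K G : LeavittPathAlgebra K G →ₗ[K] _), fun v => ?_,
    fun x d hx hd => ?_⟩
  · exact (congrArg f ((hcoeff (isHomogeneous_vertex v)).trans Finsupp.single_eq_same)).trans
      (hf v)
  · exact (congrArg f ((hcoeff hx).trans (Finsupp.single_eq_of_ne hd.symm))).trans (map_zero f)

end Grading

section Transfer

variable [Fintype E]

variable (K G) in
/-- The map `x ↦ ∑ e, e* x e`. It rotates paths, taking `e x` to `x e` whenever this makes sense,
so that it identifies elements with the same cyclic words. -/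
def transfer : Module.End K (LeavittPathAlgebra K G) :=
  ∑ e, LinearMap.mulLeftRight K (T e, S e)

theorem transfer_apply (x : LeavittPathAlgebra K G) : transfer K G x = ∑ e, T e * x * S e := by
  simp [transfer]

theorem IsHomogeneous.transfer {x : LeavittPathAlgebra K G} {d : ℤ} (hx : IsHomogeneous G x d) :
    IsHomogeneous G (transfer K G x) d := by
  rw [transfer_apply]
  refine isHomogeneous_sum fun e _ => ?_
  simpa using ((isHomogeneous_ghost e).mul hx).mul (isHomogeneous_edge e)

theorem transfer_vertex_mul (v : V) (x : LeavittPathAlgebra K G) :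
    transfer K G (P v * x) = transfer K G (x * P v) := by
  classical
  simp only [transfer_apply]
  refine Finset.sum_congr rfl fun e _ => ?_
  rw [← mul_assoc, ghost_mul_vertex, ← mul_assoc, mul_assoc _ (P v), vertex_mul_edge]
  split_ifs <;> simp_all

theorem transfer_edge_mul (e : E) (x : LeavittPathAlgebra K G) :
    transfer K G (S e * x) = P (G.r e) * x * S e := by
  classical
  rw [transfer_apply, Finset.sum_eq_single e]
  · rw [← mul_assoc, ghost_mul_edge, if_pos rfl]
  · intro f _ hf
    rw [← mul_assoc, ghost_mul_edge, if_neg hf, zero_mul, zero_mul]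
  · simp

theorem transfer_mul_ghost (x : LeavittPathAlgebra K G) (e : E) :
    transfer K G (x * T e) = T e * x * P (G.r e) := by
  classical
  rw [transfer_apply, Finset.sum_eq_single e]
  · rw [← mul_assoc, mul_assoc, ghost_mul_edge, if_pos rfl]
  · intro f _ hf
    rw [← mul_assoc, mul_assoc, ghost_mul_edge, if_neg hf.symm, mul_zero]
  · simp

theorem transfer_vertex [DecidableEq V] (v : V) :
    transfer K G (P v) = ∑ e with G.s e = v, P (G.r e) := by
  classical
  rw [transfer_apply, Finset.sum_filter]
  refine Finset.sum_congr rfl fun e _ => ?_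
  rw [ghost_mul_vertex]
  split_ifs
  · rw [ghost_mul_edge, if_pos rfl]
  · rw [zero_mul]

end Transfer

section Trace

theorem ghostProd_mul_vertex_eq_or (v : V) {β : List E} (hβ : β ≠ []) :
    ghostProd K G β * P v = ghostProd K G β ∨ ghostProd K G β * P v = 0 := by
  classical
  obtain ⟨γ, e, rfl⟩ := List.eq_nil_or_concat' β |>.resolve_left hβ
  rw [ghostProd_append, ghostProd_cons, ghostProd_nil, mul_one, mul_assoc, ghost_mul_vertex]
  split_ifs <;> simp

theorem vertex_mul_edgeProd_mul_ghostProd_mul_vertex_eq_or (v : V) {α β : List E}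
    (hαβ : α.length = β.length) :
    P v * (edgeProd K G α * ghostProd K G β) * P v = P v ∨
      P v * (edgeProd K G α * ghostProd K G β) * P v = edgeProd K G α * ghostProd K G β ∨
        P v * (edgeProd K G α * ghostProd K G β) * P v = 0 := by
  obtain rfl | hα := eq_or_ne α []
  · obtain rfl := List.length_eq_zero_iff.1 hαβ.symm
    exact .inl (by simpa using (isFamily K G).vertex_mul_self v)
  · have hβ : β ≠ [] := List.length_pos_iff.1 (hαβ ▸ List.length_pos_iff.2 hα)
    rw [← mul_assoc, mul_assoc]
    rcases vertex_mul_edgeProd_eq_or (K := K) (G := G) v hα with h | h <;>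
      rcases ghostProd_mul_vertex_eq_or (K := K) (G := G) v hβ with h' | h' <;> simp [h, h']

variable [Fintype E] {ε : V → K} {t : LeavittPathAlgebra K G →ₗ[K] K}

theorem apply_transfer_pow_vertex [DecidableEq V] (hε : ∀ v, ∑ e with G.s e = v, ε (G.r e) = ε v)
    (ht : ∀ v, t (P v) = ε v) (n : ℕ) (v : V) : t ((transfer K G ^ n) (P v)) = ε v := by
  induction n generalizing v with
  | zero => exact ht v
  | succ n ih =>
    rw [pow_succ, Module.End.mul_apply, transfer_vertex, map_sum, map_sum, ← hε v]
    exact Finset.sum_congr rfl fun e _ => ih (G.r e)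

theorem transfer_vertex_sub_self_mem [DecidableEq V]
    (hε : ∀ v, ∑ e with G.s e = v, ε (G.r e) = ε v) (ht : ∀ v, t (P v) = ε v) (v : V) :
    transfer K G (P v) - P v ∈ eventualKer (transfer K G) t := .of_forall fun n => by
  rw [map_sub, map_sub, ← Module.End.mul_apply, ← pow_succ, apply_transfer_pow_vertex hε ht,
    apply_transfer_pow_vertex hε ht, sub_self]

theorem mem_eventualKer_of_isHomogeneous (ht0 : ∀ x d, IsHomogeneous G x d → d ≠ 0 → t x = 0)
    {x : LeavittPathAlgebra K G} {d : ℤ} (hx : IsHomogeneous G x d) (hd : d ≠ 0) :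
    x ∈ eventualKer (transfer K G) t := .of_forall fun n => by
  refine ht0 _ d ?_ hd
  induction n with
  | zero => exact hx
  | succ n ih => rw [pow_succ', Module.End.mul_apply]; exact ih.transfer

theorem transfer_edge_mul_mul_ghost [DecidableEq E] (e f : E) (x : LeavittPathAlgebra K G) :
    transfer K G (S e * (x * T f)) = if f = e then P (G.r e) * x * P (G.r e) else 0 := by
  rw [transfer_edge_mul, ← mul_assoc, mul_assoc _ (T f), ghost_mul_edge]
  split_ifs with h
  · rw [h]
  · rw [mul_zero]

theorem transfer_monomial_sub_self_mem [DecidableEq V]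
    (hε : ∀ v, ∑ e with G.s e = v, ε (G.r e) = ε v) (ht : ∀ v, t (P v) = ε v) {α β : List E}
    (hαβ : α.length = β.length) :
    transfer K G (edgeProd K G α * ghostProd K G β) - edgeProd K G α * ghostProd K G β ∈
      eventualKer (transfer K G) t := by
  classical
  induction α generalizing β with
  | nil =>
    obtain rfl := List.length_eq_zero_iff.1 hαβ.symm
    rw [edgeProd_nil, ghostProd_nil, mul_one, ← sum_vertex, map_sum, ← Finset.sum_sub_distrib]
    exact sum_mem fun v _ => transfer_vertex_sub_self_mem hε ht v
  | cons e α ih =>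
    obtain ⟨γ, f, rfl⟩ := List.eq_nil_or_concat' β |>.resolve_left (by rintro rfl; simp at hαβ)
    rw [edgeProd_cons, ghostProd_append, ghostProd_cons, ghostProd_nil, mul_one, mul_assoc,
      ← mul_assoc (edgeProd K G α)]
    refine mem_eventualKer_of_apply_mem ?_
    rw [map_sub, transfer_edge_mul_mul_ghost]
    have hαγ : α.length = γ.length := by simpa using hαβ
    split_ifs
    · rcases vertex_mul_edgeProd_mul_ghostProd_mul_vertex_eq_or (K := K) (G := G) (G.r e) hαγ
        with h | h | h <;> rw [h]
      · exact transfer_vertex_sub_self_mem hε ht _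
      · exact ih hαγ
      · simp
    · simp

theorem transfer_sub_self_mem [DecidableEq V] (hreg : ∀ v, G.IsRegular v)
    (hε : ∀ v, ∑ e with G.s e = v, ε (G.r e) = ε v) (ht : ∀ v, t (P v) = ε v)
    (ht0 : ∀ x d, IsHomogeneous G x d → d ≠ 0 → t x = 0) (x : LeavittPathAlgebra K G) :
    transfer K G x - x ∈ eventualKer (transfer K G) t := by
  suffices h : monomialSpan K G ≤ (eventualKer (transfer K G) t).comap (transfer K G - 1) from
    h (monomialSpan_eq_top (K := K) hreg ▸ Submodule.mem_top)
  refine Submodule.span_le.2 ?_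
  rintro _ ⟨α, β, rfl⟩
  by_cases hαβ : α.length = β.length
  · exact transfer_monomial_sub_self_mem hε ht hαβ
  · have hx := (isHomogeneous_edgeProd (K := K) (G := G) α).mul (isHomogeneous_ghostProd β)
    have hd : (α.length + -β.length : ℤ) ≠ 0 := by omega
    exact sub_mem (mem_eventualKer_of_isHomogeneous ht0 hx.transfer hd)
      (mem_eventualKer_of_isHomogeneous ht0 hx hd)

section CommutatorMem

variable {N : Submodule K (LeavittPathAlgebra K G)} (hN : ∀ x, transfer K G x - x ∈ N)
include hN

theorem vertex_mul_sub_mul_vertex_mem (v : V) (x : LeavittPathAlgebra K G) :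
    P v * x - x * P v ∈ N := by
  have h := N.sub_mem (hN (x * P v)) (hN (P v * x))
  rwa [transfer_vertex_mul, sub_sub_sub_cancel_left] at h

theorem edge_mul_sub_mul_edge_mem (e : E) (x : LeavittPathAlgebra K G) :
    S e * x - x * S e ∈ N := by
  have h := N.sub_mem (vertex_mul_sub_mul_vertex_mem hN (G.r e) (x * S e)) (hN (S e * x))
  rwa [transfer_edge_mul, mul_assoc x, (isFamily K G).edge_mul_range, mul_assoc,
    sub_sub_sub_cancel_left] at h

theorem ghost_mul_sub_mul_ghost_mem (e : E) (x : LeavittPathAlgebra K G) :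
    T e * x - x * T e ∈ N := by
  have h := N.add_mem (vertex_mul_sub_mul_vertex_mem hN (G.r e) (T e * x)) (hN (x * T e))
  rwa [transfer_mul_ghost, ← mul_assoc, (isFamily K G).range_mul_ghost,
    sub_add_sub_cancel] at h

theorem mul_sub_mul_mem_of_transfer_sub_self_mem (x y : LeavittPathAlgebra K G) :
    x * y - y * x ∈ N := by
  induction x using LeavittPathAlgebra.induction generalizing y with
  | algebraMap k => rw [Algebra.commutes, sub_self]; exact N.zero_mem
  | of g =>
    cases g with
    | vertex v => exact vertex_mul_sub_mul_vertex_mem hN v y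
    | edge e => exact edge_mul_sub_mul_edge_mem hN e y
    | ghost e => exact ghost_mul_sub_mul_ghost_mem hN e y
  | mul a b ha hb =>
    have h := N.add_mem (ha (b * y)) (hb (y * a))
    rwa [← mul_assoc, ← mul_assoc, mul_assoc y, mul_assoc b, sub_add_sub_cancel] at h
  | add a b ha hb =>
    rw [add_mul, mul_add, add_sub_add_comm]
    exact N.add_mem (ha y) (hb y)

end CommutatorMem

theorem one_notMem_commutators [DecidableEq V] (hreg : ∀ v, G.IsRegular v)
    (hε : ∀ v, ∑ e with G.s e = v, ε (G.r e) = ε v) (hsum : ∑ v, ε v ≠ 0) :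
    1 ∉ commutators K G := by
  obtain ⟨t, ht, ht0⟩ := exists_linearMap_vertex_eq_and_isHomogeneous_eq_zero hreg ε
  have hcomm : (commutators K G).toSubmodule ≤ eventualKer (transfer K G) t :=
    derivedSeries_one_le_iff.2
      (mul_sub_mul_mem_of_transfer_sub_self_mem (transfer_sub_self_mem hreg hε ht ht0))
  intro h
  obtain ⟨n, hn⟩ := (hcomm h).exists
  rw [← sum_vertex, map_sum, map_sum] at hn
  exact hsum (by simpa only [apply_transfer_pow_vertex hε ht] using hn)

end Trace

section LieSimple

variable [Fintype E]

theorem sum_edge_mul_ghost (hreg : ∀ v, G.IsRegular v) : ∑ e, S e * T e = 1 := by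
  classical
  rw [← sum_vertex, ← Finset.sum_fiberwise Finset.univ G.s]
  refine Finset.sum_congr rfl fun v _ => ?_
  rw [(isFamily K G).vertex_eq_sum v (hreg v)]
  exact Finset.sum_congr (by ext; simp) fun _ _ => rfl

theorem completeOrthogonalIdempotents_edge_mul_ghost (hreg : ∀ v, G.IsRegular v) :
    CompleteOrthogonalIdempotents fun e => S e * T e := by
  classical
  refine CompleteOrthogonalIdempotents.iff_ortho_complete.2
    ⟨fun e f hef => ?_, sum_edge_mul_ghost hreg⟩
  change S e * T e * (S f * T f) = 0
  rw [mul_assoc, ← mul_assoc (T e), ghost_mul_edge, if_neg hef, zero_mul, mul_zero]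

omit [Fintype E] in
theorem edge_mul_ghost_ne_zero (hreg : ∀ v, G.IsRegular v) (e : E) : S e * T e ≠ 0 := by
  intro h
  refine vertex_ne_zero (K := K) hreg (G.r e) ?_
  rw [← (isFamily K G).vertex_mul_self, ← (isFamily K G).ghost_mul_edge_self, mul_assoc,
    ← mul_assoc (S e), h, zero_mul, mul_zero]

theorem isSimple_commutators [DecidableEq V] [IsSimpleRing (LeavittPathAlgebra K G)]
    (hreg : ∀ v, G.IsRegular v) (hcard : 3 ≤ Fintype.card E) {ε : V → K}
    (hε : ∀ v, ∑ e with G.s e = v, ε (G.r e) = ε v) (hsum : ∑ v, ε v ≠ 0) :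
    LieAlgebra.IsSimple K (commutators K G) :=
  isSimple_derivedSeries_one (completeOrthogonalIdempotents_edge_mul_ghost hreg)
    (edge_mul_ghost_ne_zero hreg) (by simpa using hcard) (one_notMem_commutators hreg hε hsum)

end LieSimple

end LeavittPathAlgebra

section TwoVertexGraph

variable {p u : ℕ} (v : ℕ)

theorem twoVertexGraph_exists_edge (hp : 0 < p) (hu : 0 < u) (a b : Fin 2) :
    ∃ e, (twoVertexGraph u v p).s e = a ∧ (twoVertexGraph u v p).r e = b := by
  have hpu := Nat.mul_pos hp hu
  fin_cases a <;> fin_cases b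
  · exact ⟨.inl ⟨0, by omega⟩, rfl, rfl⟩
  · exact ⟨.inr (.inl ⟨0, hu⟩), rfl, rfl⟩
  · exact ⟨.inr (.inr (.inl ⟨0, hpu⟩)), rfl, rfl⟩
  · exact ⟨.inr (.inr (.inr ⟨0, by omega⟩)), rfl, rfl⟩

theorem twoVertexGraph_isRegular (hp : 0 < p) (hu : 0 < u) (a : Fin 2) :
    (twoVertexGraph u v p).IsRegular a :=
  ⟨Set.toFinite _, (twoVertexGraph_exists_edge v hp hu a a).imp fun _ => And.left⟩

theorem twoVertexGraph_exists_loop_and_edge_ne (hp : 0 < p) (hu : 0 < u) (a : Fin 2) :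
    ∃ e f, e ≠ f ∧ (twoVertexGraph u v p).s e = a ∧ (twoVertexGraph u v p).r e = a ∧
      (twoVertexGraph u v p).s f = a := by
  obtain ⟨e, hes, her⟩ := twoVertexGraph_exists_edge v hp hu a a
  obtain ⟨f, hfs, hfr⟩ := twoVertexGraph_exists_edge v hp hu a (a + 1)
  refine ⟨e, f, ?_, hes, her, hfs⟩
  rintro rfl
  exact absurd (her.symm.trans hfr) (by simp)

theorem twoVertexGraph_isSimpleRing (hp : 0 < p) (hu : 0 < u) (K : Type*) [Field K] :
    IsSimpleRing (LeavittPathAlgebra K (twoVertexGraph u v p)) :=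
  LeavittPathAlgebra.isSimpleRing (twoVertexGraph_isRegular v hp hu)
    (twoVertexGraph_exists_loop_and_edge_ne v hp hu)
    fun a b => .single (twoVertexGraph_exists_edge v hp hu a b)

theorem twoVertexGraph_sum_range_eq (p u v : ℕ) (K : Type*) [Field K] [CharP K p] (a : Fin 2) :
    ∑ e with (twoVertexGraph u v p).s e = a,
      (Pi.single 0 1 : Fin 2 → K) ((twoVertexGraph u v p).r e) = (Pi.single 0 1 : Fin 2 → K) a := by
  rw [Finset.sum_filter]
  fin_cases a <;> simp [Fintype.sum_sum_type, twoVertexGraph]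

end TwoVertexGraph

theorem mainTheorem10_general {p u : ℕ} (v : ℕ) (hp : 0 < p) (hu : 0 < u) (K : Type*) [Field K] :
    IsSimpleRing (LeavittPathAlgebra K (twoVertexGraph u v p)) ∧
      (CharP K p →
        LieAlgebra.IsSimple K (LeavittPathAlgebra.commutators K (twoVertexGraph u v p))) := by
  have hsimple := twoVertexGraph_isSimpleRing v hp hu K
  refine ⟨hsimple, fun _ => ?_⟩
  refine LeavittPathAlgebra.isSimple_commutators (twoVertexGraph_isRegular v hp hu) ?_
    (twoVertexGraph_sum_range_eq p u v K) ?_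
  · have := Nat.mul_pos hp hu
    simp only [Fintype.card_sum, Fintype.card_fin]
    omega
  · simp

theorem mainTheorem10 (p u v : ℕ) (hp : p.Prime) (hu : 2 ≤ u) (hv : 2 ≤ v)
    (K : Type*) [Field K] :
    IsSimpleRing (LeavittPathAlgebra K (twoVertexGraph u v p)) ∧
      (CharP K p →
        LieAlgebra.IsSimple K (LeavittPathAlgebra.commutators K (twoVertexGraph u v p))) :=
  mainTheorem10_general v hp.pos (by omega) K
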